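/- Let $\Omega$ be an infinite set of states with a $\sigma$-algebra of events (for instance all subsets of $\Omega$), let $\mathbb{X}$ be an infinite set of outcomes, and let $N=\{1,\dots,n\}$ with $n\ge 2$. Let $\mathcal P$ be the set of countably additive, nonatomic probability measures on the events. For a countable $X\subseteq\mathbb{X}$ with $|X|\ge 2$, let $F_X$ be the set of (simple) acts $f:\Omega\to X$ with finite range and with every $f^{-1}(x)$ an event; outcomes are identified with constant acts. A binary relation $R_i$ on $F_X$ is an SEU preference if there are a nonconstant bounded $u_i:X\to\mathbb{R}$ and $p_i\in\mathcal P$ with $f\,R_i\,g\iff\int u_i(f)\,dp_i\ge\int u_i(g)\,dp_i$; here $p_i$ is unique and $u_i$ is unique up to positive affine transformations. A problem $(X,R_N)$ consists of such an $X$ and a profile $R_N=(R_1,\dots,R_n)$ of SEU preferences on $F_X$ for which every individual has a best and a worst outcome in $X$. Let $u_i^*(\cdot;X,R_N)$ be the value function normalized to have supremum $1$ and infimum $0$, let $U_i^*(f;X,R_N)=\int u_i^*(f;X,R_N)\,dp_i$, $u^*=(u^*_i)_{i\in N}$ and $U^*=(U^*_i)_{i\in N}$. An aggregation rule $\mathbf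 R$ assigns to each problem $(X,R_N)$ a complete and transitive relation $\mathbf R(X,R_N)$ on $F_X$. Write $P_i$ and $\mathbf P$ for asymmetric parts. Consider the following axioms, each required for all problems. * Pareto principle: for $f,g\in F_X$, if $f\,R_i\,g$ for all $i$, then $f\,\mathbf R(X,R_N)\,g$; if $f\,P_i\,g$ for all $i$, then $f\,\mathbf P(X,R_N)\,g$. * Continuity: if $f,g,f^1,f^2,\dots\in F_X$ and $U^*(f^t;X,R_N)\to U^*(f;X,R_N)$, then $f^t\,\mathbf R(X,R_N)\,g$ for all $t$ implies $f\,\mathbf R(X,R_N)\,g$, and $g\,\mathbf R(X,R_N)\,f^t$ for all $t$ implies $g\,\mathbf R(X,R_N)\,f$. * Independence of inessential expansions (IIE): if $X\subseteq X'$, each $R'_i$ coincides with $R_i$ on $F_X$, and for all $x'\in X'$ and $i\in N$ there are $x^+,x^-\in X$ with $x^+R'_i\,x'\,R'_i\,x^-$, then $\mathbf R(X',R'_N)$ coincides with $\mathbf R(X,R_N)$ on $F_X$. * Belief irrelevance: if $u^*(\cdot;X,R_N)=u^*(\cdot;X,R'_N)$, then for all $x,y\in X$, $x\,\mathbf R(X,R_N)\,y\iff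 x\,\mathbf R(X,R'_N)\,y$. * Restricted certainty independence: if $u_i^*(\cdot;X,R_N)=u_j^*(\cdot;X,R_N)$ for all $i,j$, then for all $f,g\in F_X$, $x\in X$, $\alpha\in(0,1)$ and all pseudo-mixed acts $f_{\alpha x}$ of $f$ and $x$ and $g_{\alpha x}$ of $g$ and $x$, $f\,\mathbf R(X,R_N)\,g\iff f_{\alpha x}\,\mathbf R(X,R_N)\,g_{\alpha x}$. Here $f_{\alpha x}\in F_X$ is a pseudo-mixed act of $f$ and $x$ if for all $i\in N$, $p_i(f_{\alpha x}^{-1}(x))=\alpha p_i(f^{-1}(x))+1-\alpha$ and $p_i(f_{\alpha x}^{-1}(y))=\alpha p_i(f^{-1}(y))$ for all $y\in X\setminus\{x\}$. Then an aggregation rule $\mathbf R$ satisfies the Pareto principle, continuity, IIE, belief irrelevance and restricted certainty independence if and only if there is a single function $\psi:[0,1]^N\to\mathbb{R}$, independent of the problem and of the beliefs, such that for every problem $(X,R_N)$ and all $f,g\in F_X$, $$f\,\mathbf R(X,R_N)\,g\iff\psi(U^*(f;X,R_N))\ge\psi(U^*(g;X,R_N)),$$ and such that $\psi$ is continuous,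 monotonic ($\psi(\mathbf u)>\psi(\mathbf v)$ whenever $u_i>v_i$ for all $i$), homogeneous ($\psi(\alpha\mathbf u)=\alpha\psi(\mathbf u)$ whenever $\alpha>0$ and $\mathbf u,\alpha\mathbf u\in[0,1]^N$) and translation-invariant ($\psi(\mathbf u+c\mathbf 1)=\psi(\mathbf u)+c$ whenever $c\in\mathbb R$ and $\mathbf u,\mathbf u+c\mathbf 1\in[0,1]^N$). -/

import Mathlib

open Filter Topology MeasureTheory

noncomputable section

/-- A nonatomic measure: every event of positive measure contains an event of strictly smaller
positive measure.  (This is stronger than the class `NoAtoms`, which only speaks of points.) -/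
def IsNonatomic {Ω : Type*} [MeasurableSpace Ω] (p : Measure Ω) : Prop :=
  ∀ E : Set Ω, MeasurableSet E → 0 < p E →
    ∃ F : Set Ω, MeasurableSet F ∧ F ⊆ E ∧ 0 < p F ∧ p F < p E

/-- A belief: a countably additive, nonatomic probability measure on the events. -/
def IsBelief {Ω : Type*} [MeasurableSpace Ω] (p : Measure Ω) : Prop :=
  IsProbabilityMeasure p ∧ IsNonatomic p

/-- A set of feasible outcomes: a countable set of outcomes with at least two elements. -/
structure Menu (𝕏 : Type*) where
  carrier : Set 𝕏
  countable : carrier.Countable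
  nontrivial : carrier.Nontrivial

/-- A simple `X`-valued act: it takes finitely many values in `X`, each on an event.  If every set
of states is an event, the last condition is void. -/
structure Act (Ω : Type*) [MeasurableSpace Ω] {𝕏 : Type*} (X : Menu 𝕏) where
  toFun : Ω → X.carrier
  finite_range : (Set.range toFun).Finite
  measurable_fibre : ∀ x : X.carrier, MeasurableSet (toFun ⁻¹' {x})

namespace Act

variable {Ω : Type*} [MeasurableSpace Ω] {𝕏 : Type*}

/-- The constant act. -/
def const {X : Menu 𝕏} (x : X.carrier) : Act Ω X where
  toFun := fun _ => x
  finite_range := (Set.finite_singleton x).subset (by rintro _ ⟨_, rfl⟩; rfl)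
  measurable_fibre := fun y => MeasurableSet.const (x = y)

/-- An `X`-valued act, seen as an `X'`-valued act when `X ⊆ X'`. -/
def incl {X X' : Menu 𝕏} (h : X.carrier ⊆ X'.carrier) (f : Act Ω X) : Act Ω X' where
  toFun := fun ω => Set.inclusion h (f.toFun ω)
  finite_range := by
    have := f.finite_range.image (Set.inclusion h)
    rwa [← Set.range_comp] at this
  measurable_fibre := by
    intro x
    by_cases hx : (x : 𝕏) ∈ X.carrier
    · convert f.measurable_fibre ⟨x, hx⟩ using 1
      ext ω
      simp [Set.inclusion, Subtype.ext_iff]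
    · convert MeasurableSet.empty using 1
      ext ω
      simp only [Set.mem_preimage, Set.mem_singleton_iff, Set.mem_empty_iff_false, iff_false]
      rintro rfl
      exact hx (f.toFun ω).2

end Act

/-- The subjective expected utility of an act, for the value function `u` and the belief `p`. -/
def seu {Ω : Type*} [MeasurableSpace Ω] {𝕏 : Type*} {X : Menu 𝕏}
    (u : X.carrier → ℝ) (p : Measure Ω) (f : Act Ω X) : ℝ :=
  ∫ ω, u (f.toFun ω) ∂p

/-- `u` is a value function and `p` a belief that together represent the preference `R`. -/
structure IsSEURep {Ω : Type*} [MeasurableSpace Ω] {𝕏 : Type*} {X : Menu 𝕏}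
    (R : Act Ω X → Act Ω X → Prop) (u : X.carrier → ℝ) (p : Measure Ω) : Prop where
  nonconstant : ∃ x y, u x ≠ u y
  bounded : ∃ C : ℝ, ∀ x, |u x| ≤ C
  belief : IsBelief p
  represents : ∀ f g, R f g ↔ seu u p f ≥ seu u p g

/-- `R` is a subjective expected utility preference. -/
def IsSEU {Ω : Type*} [MeasurableSpace Ω] {𝕏 : Type*} {X : Menu 𝕏}
    (R : Act Ω X → Act Ω X → Prop) : Prop :=
  ∃ (u : X.carrier → ℝ) (p : Measure Ω), IsSEURep R u p

/-- A profile of `n` subjective expected utility preferences over the `X`-valued acts, in which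
every individual has a best and a worst outcome in `X`.  A problem is a pair of an `X : Menu 𝕏`
and a `Profile Ω X n`. -/
structure Profile (Ω : Type*) [MeasurableSpace Ω] {𝕏 : Type*} (X : Menu 𝕏) (n : ℕ) where
  pref : Fin n → Act Ω X → Act Ω X → Prop
  isSEU : ∀ i, IsSEU (pref i)
  exists_best : ∀ i, ∃ b : X.carrier, ∀ x : X.carrier, pref i (Act.const b) (Act.const x)
  exists_worst : ∀ i, ∃ w : X.carrier, ∀ x : X.carrier, pref i (Act.const x) (Act.const w)

namespace Profile

variable {Ω : Type*} [MeasurableSpace Ω] {𝕏 : Type*} {X : Menu 𝕏} {n : ℕ}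

/-- A value function of individual `i` (unique up to positive affine transformations). -/
def value (P : Profile Ω X n) (i : Fin n) : X.carrier → ℝ :=
  (P.isSEU i).choose

/-- The (unique) belief of individual `i`. -/
def belief (P : Profile Ω X n) (i : Fin n) : Measure Ω :=
  (P.isSEU i).choose_spec.choose

theorem isSEURep (P : Profile Ω X n) (i : Fin n) :
    IsSEURep (P.pref i) (P.value i) (P.belief i) :=
  (P.isSEU i).choose_spec.choose_spec

/-- The 0-1 normalized value function: the positive affine transformation of a value function
with supremum 1 and infimum 0. -/
def normValue (P : Profile Ω X n) (i : Fin n) (x : X.carrier) : ℝ :=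
  (P.value i x - ⨅ y, P.value i y) / ((⨆ y, P.value i y) - ⨅ y, P.value i y)

/-- The vector of 0-1 normalized expected utilities of an act. -/
def normUtil (P : Profile Ω X n) (f : Act Ω X) : Fin n → ℝ :=
  fun i => seu (P.normValue i) (P.belief i) f

/-- `h` is a pseudo-mixed act of `f` and `x`, with weight `α` on `f`. -/
def IsPseudoMix (P : Profile Ω X n) (α : ℝ) (f : Act Ω X) (x : X.carrier) (h : Act Ω X) : Prop :=
  ∀ i : Fin n,
    (P.belief i).real (h.toFun ⁻¹' {x}) = α * (P.belief i).real (f.toFun ⁻¹' {x}) + (1 - α) ∧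
    ∀ y, y ≠ x →
      (P.belief i).real (h.toFun ⁻¹' {y}) = α * (P.belief i).real (f.toFun ⁻¹' {y})

/-- `(X', P')` is an inessential expansion of `(X, P)`. -/
def IsInessentialExpansion {X' : Menu 𝕏} (P : Profile Ω X n) (P' : Profile Ω X' n) : Prop :=
  ∃ h : X.carrier ⊆ X'.carrier,
    (∀ i f g, P'.pref i (f.incl h) (g.incl h) ↔ P.pref i f g) ∧
    ∀ (x' : X'.carrier) (i : Fin n), ∃ xp xm : X.carrier,
      P'.pref i (Act.const (Set.inclusion h xp)) (Act.const x') ∧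
      P'.pref i (Act.const x') (Act.const (Set.inclusion h xm))

end Profile

/-- An aggregation rule: it assigns to each problem a complete and transitive relation over
the acts. -/
structure AggregationRule (Ω : Type*) [MeasurableSpace Ω] (𝕏 : Type*) (n : ℕ) where
  rel : (X : Menu 𝕏) → Profile Ω X n → Act Ω X → Act Ω X → Prop
  complete : ∀ X P f g, rel X P f g ∨ rel X P g f
  transitive : ∀ X P f g h, rel X P f g → rel X P g h → rel X P f h

namespace AggregationRule

variable {Ω : Type*} [MeasurableSpace Ω] {𝕏 : Type*} {n : ℕ}

def Pareto (R : AggregationRule Ω 𝕏 n) : Prop :=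
  ∀ (X : Menu 𝕏) (P : Profile Ω X n) (f g : Act Ω X),
    ((∀ i, P.pref i f g) → R.rel X P f g) ∧
    ((∀ i, P.pref i f g ∧ ¬ P.pref i g f) → R.rel X P f g ∧ ¬ R.rel X P g f)

def Continuity (R : AggregationRule Ω 𝕏 n) : Prop :=
  ∀ (X : Menu 𝕏) (P : Profile Ω X n) (f g : Act Ω X) (s : ℕ → Act Ω X),
    Tendsto (fun t => P.normUtil (s t)) atTop (𝓝 (P.normUtil f)) →
    ((∀ t, R.rel X P (s t) g) → R.rel X P f g) ∧
    ((∀ t, R.rel X P g (s t)) → R.rel X P g f)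

/-- Independence of inessential expansions. -/
def IIE (R : AggregationRule Ω 𝕏 n) : Prop :=
  ∀ (X X' : Menu 𝕏) (P : Profile Ω X n) (P' : Profile Ω X' n),
    P.IsInessentialExpansion P' →
    ∀ (h : X.carrier ⊆ X'.carrier) (f g : Act Ω X),
      R.rel X' P' (f.incl h) (g.incl h) ↔ R.rel X P f g

def BeliefIrrelevance (R : AggregationRule Ω 𝕏 n) : Prop :=
  ∀ (X : Menu 𝕏) (P P' : Profile Ω X n), (∀ i x, P.normValue i x = P'.normValue i x) →
    ∀ x y : X.carrier,
      R.rel X P (Act.const x) (Act.const y) ↔ R.rel X P' (Act.const x) (Act.const y)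

/-- Restricted certainty independence; pseudo-mixed acts are not unique, and the axiom speaks of
all of them. -/
def RestrictedCertaintyIndependence (R : AggregationRule Ω 𝕏 n) : Prop :=
  ∀ (X : Menu 𝕏) (P : Profile Ω X n), (∀ i j x, P.normValue i x = P.normValue j x) →
    ∀ (f g : Act Ω X) (x : X.carrier) (α : ℝ), 0 < α → α < 1 →
    ∀ fx gx : Act Ω X, P.IsPseudoMix α f x fx → P.IsPseudoMix α g x gx →
      (R.rel X P f g ↔ R.rel X P fx gx)

end AggregationRule

/-- The cube `[0,1]^N`. -/
def cube (n : ℕ) : Set (Fin n → ℝ) := {u | ∀ i, 0 ≤ u i ∧ u i ≤ 1}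

/-- Monotonicity on the cube: `ψ u > ψ v` whenever `u` exceeds `v` in every coordinate. -/
def IsMonotonic {n : ℕ} (ψ : cube n → ℝ) : Prop :=
  ∀ u v : cube n, (∀ i, u.1 i > v.1 i) → ψ u > ψ v

/-- `ψ (α u) = α ψ u` for all `α > 0` for which `α u` is in the cube. -/
def IsHomogeneous {n : ℕ} (ψ : cube n → ℝ) : Prop :=
  ∀ (u v : cube n) (α : ℝ), 0 < α → (∀ i, v.1 i = α * u.1 i) → ψ v = α * ψ u

/-- `ψ (u + c 1) = ψ u + c` for all real `c` for which `u + c 1` is in the cube. -/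
def IsTranslationInvariant {n : ℕ} (ψ : cube n → ℝ) : Prop :=
  ∀ (u v : cube n) (c : ℝ), (∀ i, v.1 i = u.1 i + c) → ψ v = ψ u + c

namespace Profile

variable {Ω : Type*} [MeasurableSpace Ω] {𝕏 : Type*} {X : Menu 𝕏} {n : ℕ}

theorem normValue_mem (P : Profile Ω X n) (i : Fin n) (x : X.carrier) :
    0 ≤ P.normValue i x ∧ P.normValue i x ≤ 1 := by
  obtain ⟨C, hC⟩ := (P.isSEURep i).bounded
  have ha : BddAbove (Set.range (P.value i)) :=
    ⟨C, by rintro _ ⟨y, rfl⟩; exact (abs_le.1 (hC y)).2⟩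
  have hb : BddBelow (Set.range (P.value i)) :=
    ⟨-C, by rintro _ ⟨y, rfl⟩; exact (abs_le.1 (hC y)).1⟩
  have h1 := le_ciSup ha x
  have h2 := ciInf_le hb x
  unfold normValue
  exact ⟨div_nonneg (by linarith) (by linarith), div_le_one_of_le₀ (by linarith) (by linarith)⟩

theorem normUtil_mem (P : Profile Ω X n) (f : Act Ω X) : P.normUtil f ∈ cube n := by
  intro i
  have : IsProbabilityMeasure (P.belief i) := (P.isSEURep i).belief.1
  refine ⟨integral_nonneg fun ω => (P.normValue_mem i _).1, ?_⟩
  have h := norm_integral_le_of_norm_le_const (μ := P.belief i) (C := 1)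
    (f := fun ω => P.normValue i (f.toFun ω)) (ae_of_all _ fun ω => by
      rw [Real.norm_eq_abs, abs_of_nonneg (P.normValue_mem i _).1]
      exact (P.normValue_mem i _).2)
  have h' := (Real.le_norm_self _).trans h
  simpa [normUtil, seu] using h'

end Profile

end

/-! Necessity: a pseudo-mixture of `f` and `x` has utility vector `α U(f) + (1 - α) U(x)`; with
common values `U(x)` lies on the diagonal, and `ψ` is affine along such mixtures by homogeneity and
translation invariance. The other axioms follow from continuity, monotonicity and the uniqueness of
normalized representations.

Sufficiency has three ingredients. Welfarism (`rel_iff_utilRel`): only utility vectors matter. Two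
acts can be compared through fresh outcomes with the same utility vectors: restrict to a finite
menu, adjoin the fresh outcomes by IIE, exchange them for the acts by Pareto, and change the beliefs
by belief irrelevance, which is allowed once only outcomes are compared. The resulting order on the
cube is total, transitive, continuous and monotonic, hence represented by its diagonal equivalent
`ψ` (`exists_cube_representation`).

Certainty affinity (`isCertaintyAffine_of_rci`): give all individuals the same values, but beliefs
under which one event `E` has probability `u i` for `i`. The bet on `E` then has utility vector `u`
and is indifferent to a sure outcome of value `ψ u`. Mixing both with an outcome of value `c`
preserves the indifference, so `ψ (α u + (1 - α) c 1) = α ψ u + (1 - α) c`. Homogeneity and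
translation invariance are consequences. Sierpiński's theorem supplies the events, and also the
uniqueness of beliefs. -/

noncomputable section

/-! ### Intermediate values of nonatomic measures -/

section Nonatomic

variable {Ω : Type*} [MeasurableSpace Ω] {p : Measure Ω}

/-- One step of an exhaustion: the supremum of the measures of admissible extensions need not be
attained, but some extension realizes at least half of the possible gain. -/
theorem exists_greedy_extension {E : Set Ω} {t : ℝ} {F : Set Ω} (hF : MeasurableSet F)
    (hFE : F ⊆ E) (hFt : p.real F ≤ t) :
    ∃ F', (MeasurableSet F' ∧ F' ⊆ E ∧ p.real F' ≤ t) ∧ F ⊆ F' ∧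
      ∀ H, MeasurableSet H → F ⊆ H → H ⊆ E → p.real H ≤ t →
        p.real H - p.real F ≤ 2 * (p.real F' - p.real F) := by
  set S : Set ℝ := p.real '' {H | MeasurableSet H ∧ F ⊆ H ∧ H ⊆ E ∧ p.real H ≤ t} with hS
  have hbdd : BddAbove S := ⟨t, by rintro _ ⟨H, hH, rfl⟩; exact hH.2.2.2⟩
  have hmem : p.real F ∈ S := ⟨F, ⟨hF, subset_rfl, hFE, hFt⟩, rfl⟩
  have hle : ∀ H, MeasurableSet H → F ⊆ H → H ⊆ E → p.real H ≤ t → p.real H ≤ sSup S :=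
    fun H h1 h2 h3 h4 => le_csSup hbdd ⟨H, ⟨h1, h2, h3, h4⟩, rfl⟩
  rcases (le_csSup hbdd hmem).eq_or_lt with hc | hc
  · refine ⟨F, ⟨hF, hFE, hFt⟩, subset_rfl, fun H h1 h2 h3 h4 => ?_⟩
    have := hle H h1 h2 h3 h4
    linarith
  · obtain ⟨_, ⟨F', hF', rfl⟩, hlt⟩ :=
      exists_lt_of_lt_csSup ⟨_, hmem⟩ (show (sSup S + p.real F) / 2 < sSup S by linarith)
    refine ⟨F', ⟨hF'.1, hF'.2.2⟩, hF'.2.1, fun H h1 h2 h3 h4 => ?_⟩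
    have := hle H h1 h2 h3 h4
    linarith

variable [IsFiniteMeasure p]

theorem IsNonatomic.exists_real (hp : IsNonatomic p) {E : Set Ω} (hE : MeasurableSet E)
    (h : 0 < p.real E) :
    ∃ F, MeasurableSet F ∧ F ⊆ E ∧ 0 < p.real F ∧ p.real F < p.real E := by
  have h' : 0 < p E := by
    by_contra hc
    have : p E = 0 := by simpa using hc
    simp [Measure.real, this] at h
  obtain ⟨F, hF, hFE, h0, h1⟩ := hp E hE h'
  refine ⟨F, hF, hFE, ENNReal.toReal_pos h0.ne' (measure_ne_top _ _), ?_⟩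
  exact (ENNReal.toReal_lt_toReal (measure_ne_top _ _) (measure_ne_top _ _)).2 h1

/-- Split the set by nonatomicity and keep the smaller piece, again and again. -/
theorem IsNonatomic.exists_le_half_pow (hp : IsNonatomic p) {E : Set Ω} (hE : MeasurableSet E)
    (h : 0 < p.real E) (k : ℕ) :
    ∃ F, MeasurableSet F ∧ F ⊆ E ∧ 0 < p.real F ∧ p.real F ≤ p.real E * (1 / 2) ^ k := by
  induction k with
  | zero => exact ⟨E, hE, subset_rfl, h, by simp⟩
  | succ k ih =>
    obtain ⟨F, hF, hFE, h0, h1⟩ := ih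
    obtain ⟨G, hG, hGF, hG0, hG1⟩ := hp.exists_real hF h0
    have hd : p.real (F \ G) = p.real F - p.real G := measureReal_sdiff hGF hG
    rw [pow_succ]
    rcases le_total (p.real G) (p.real F / 2) with hc | hc
    · exact ⟨G, hG, hGF.trans hFE, hG0, by linarith⟩
    · exact ⟨F \ G, hF.diff hG, Set.sdiff_subset.trans hFE, by linarith, by linarith⟩

theorem IsNonatomic.exists_small (hp : IsNonatomic p) {E : Set Ω} (hE : MeasurableSet E)
    (h : 0 < p.real E) {ε : ℝ} (hε : 0 < ε) :
    ∃ F, MeasurableSet F ∧ F ⊆ E ∧ 0 < p.real F ∧ p.real F ≤ ε := by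
  obtain ⟨k, hk⟩ := exists_pow_lt_of_lt_one (div_pos hε h) (by norm_num : (1 / 2 : ℝ) < 1)
  obtain ⟨F, hF, hFE, h0, h1⟩ := hp.exists_le_half_pow hE h k
  refine ⟨F, hF, hFE, h0, h1.trans ?_⟩
  rw [lt_div_iff₀ h] at hk
  linarith

/-- Sierpiński's theorem: a nonatomic finite measure takes all intermediate values. -/
theorem IsNonatomic.exists_subset_real_eq (hp : IsNonatomic p) {E : Set Ω}
    (hE : MeasurableSet E) {t : ℝ} (ht0 : 0 ≤ t) (ht : t ≤ p.real E) :
    ∃ F, MeasurableSet F ∧ F ⊆ E ∧ p.real F = t := by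
  let T := {F : Set Ω // MeasurableSet F ∧ F ⊆ E ∧ p.real F ≤ t}
  have hex : ∀ F : T, ∃ F' : T, F.1 ⊆ F'.1 ∧
      ∀ H, MeasurableSet H → F.1 ⊆ H → H ⊆ E → p.real H ≤ t →
        p.real H - p.real F.1 ≤ 2 * (p.real F'.1 - p.real F.1) := fun F => by
    obtain ⟨F', h1, h2⟩ := exists_greedy_extension F.2.1 F.2.2.1 F.2.2.2
    exact ⟨⟨F', h1⟩, h2⟩
  choose next hsub hnext using hex
  let A : ℕ → T := fun k => next^[k] ⟨∅, MeasurableSet.empty, Set.empty_subset _, by simpa⟩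
  have hA : ∀ k, A (k + 1) = next (A k) := fun k => Function.iterate_succ_apply' _ _ _
  have hmono : Monotone fun k => (A k).1 := monotone_nat_of_le_succ fun k => by
    rw [hA]; exact hsub _
  set F : Set Ω := ⋃ k, (A k).1 with hFdef
  have hF : MeasurableSet F := MeasurableSet.iUnion fun k => (A k).2.1
  have hFE : F ⊆ E := Set.iUnion_subset fun k => (A k).2.2.1
  have hlim : Tendsto (fun k => p.real (A k).1) atTop (𝓝 (p.real F)) :=
    (ENNReal.tendsto_toReal (measure_ne_top _ _)).comp (tendsto_measure_iUnion_atTop hmono)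
  have hFt : p.real F ≤ t := le_of_tendsto' hlim fun k => (A k).2.2.2
  refine ⟨F, hF, hFE, hFt.antisymm ?_⟩
  by_contra! hlt
  have hd : p.real (E \ F) = p.real E - p.real F := measureReal_sdiff hFE hF
  obtain ⟨G, hG, hGE, hG0, hG1⟩ := hp.exists_small (hE.diff hF) (by linarith)
    (show 0 < t - p.real F by linarith)
  have hdisj : Disjoint F G := Set.disjoint_left.2 fun x h1 h2 => (hGE h2).2 h1
  have hu : p.real (F ∪ G) = p.real F + p.real G := measureReal_union hdisj hG
  -- `F ∪ G` is an admissible extension of every stage, so every greedy gain is at least half of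
  -- `p.real G`; yet the gains tend to 0.
  have hkey : ∀ k, p.real G ≤ 2 * (p.real (A (k + 1)).1 - p.real (A k).1) := fun k => by
    have h1 := hnext (A k) (F ∪ G) (hF.union hG)
      ((Set.subset_iUnion (fun k => (A k).1) k).trans Set.subset_union_left)
      (Set.union_subset hFE (hGE.trans Set.sdiff_subset)) (by linarith)
    have h2 : p.real (A k).1 ≤ p.real F :=
      measureReal_mono (Set.subset_iUnion (fun k => (A k).1) k)
    rw [hA]
    linarith
  have hlim0 : Tendsto (fun k => 2 * (p.real (A (k + 1)).1 - p.real (A k).1)) atTop (𝓝 0) := by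
    simpa using ((hlim.comp (tendsto_add_atTop_nat 1)).sub hlim).const_mul 2
  exact absurd (ge_of_tendsto' hlim0 hkey) (by linarith)

end Nonatomic

/-! ### Beliefs are determined by their ordering of events -/

/-- A nondecreasing additive function on `[0,1]` that fixes `1` is the identity. -/
theorem eq_self_of_additive_on_unit {φ : ℝ → ℝ}
    (hmono : ∀ a b, 0 ≤ a → a ≤ b → b ≤ 1 → φ a ≤ φ b)
    (hadd : ∀ a b, 0 ≤ a → 0 ≤ b → a + b ≤ 1 → φ (a + b) = φ a + φ b) (h1 : φ 1 = 1)
    {a : ℝ} (ha0 : 0 ≤ a) (ha1 : a ≤ 1) : φ a = a := by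
  have hz : φ 0 = 0 := by have := hadd 0 0 le_rfl le_rfl (by norm_num); simp at this; exact this
  have hmul : ∀ (x : ℝ), 0 ≤ x → ∀ k : ℕ, k * x ≤ 1 → φ (k * x) = k * φ x := by
    intro x hx k
    induction k with
    | zero => intro _; simp [hz]
    | succ k ih =>
      intro hk
      push_cast at hk ⊢
      have hkx : 0 ≤ (k : ℝ) * x := by positivity
      rw [add_mul, one_mul, hadd _ _ hkx hx (by linarith), ih (by linarith)]
      ring
  have hrat : ∀ m : ℕ, 0 < m → ∀ k : ℕ, k ≤ m → φ (k / m) = k / m := by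
    intro m hm k hk
    have hm' : (0 : ℝ) < m := by exact_mod_cast hm
    have hk' : (k : ℝ) ≤ m := by exact_mod_cast hk
    have e1 := hmul (1 / m) (by positivity) m (by field_simp; rfl)
    rw [mul_one_div_cancel hm'.ne', h1] at e1
    have e2 := hmul (1 / m) (by positivity) k (by rw [mul_one_div]; exact div_le_one_of_le₀ hk' hm'.le)
    rw [mul_one_div] at e2
    rw [e2, eq_div_iff hm'.ne']
    linear_combination (-(k : ℝ)) * e1
  have hclose : ∀ m : ℕ, 0 < m → |φ a - a| ≤ 1 / m := by
    intro m hm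
    have hm' : (0 : ℝ) < m := by exact_mod_cast hm
    -- The point `a = 1` is set apart because the grid point `(k + 1) / m` above `a` must stay in
    -- `[0,1]`.
    rcases ha1.eq_or_lt with rfl | hlt
    · simp [h1]
    set k := ⌊a * m⌋₊
    have hk1 : (k : ℝ) ≤ a * m := Nat.floor_le (by positivity)
    have hk2 : a * m < k + 1 := Nat.lt_floor_add_one _
    have hkm : k + 1 ≤ m := by
      have : (k : ℝ) < m := lt_of_le_of_lt hk1 (by nlinarith)
      exact_mod_cast this
    have l1 : (k : ℝ) / m ≤ a := by rw [div_le_iff₀ hm']; exact hk1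
    have l2 : a ≤ ((k + 1 : ℕ) : ℝ) / m := by rw [le_div_iff₀ hm']; push_cast; exact hk2.le
    have l3 : ((k + 1 : ℕ) : ℝ) / m ≤ 1 := by
      rw [div_le_one hm']; exact_mod_cast hkm
    have r1 := hmono _ _ (by positivity) l1 ha1
    have r2 := hmono _ _ ha0 l2 l3
    rw [hrat m hm k (by omega)] at r1
    rw [hrat m hm _ hkm] at r2
    have e : ((k + 1 : ℕ) : ℝ) / m = k / m + 1 / m := by push_cast; ring
    rw [abs_le]
    constructor <;> linarith
  have hl : Tendsto (fun m : ℕ => 1 / ((m : ℝ) + 1)) atTop (𝓝 0) :=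
    tendsto_one_div_add_atTop_nhds_zero_nat
  have : |φ a - a| ≤ 0 := ge_of_tendsto' hl fun m => by
    have := hclose (m + 1) (by omega); push_cast at this; exact this
  exact sub_eq_zero.1 (abs_nonpos_iff.1 this)

/-- Two beliefs that order the events in the same way are equal. -/
theorem belief_eq_of_same_order {Ω : Type*} [MeasurableSpace Ω] {p q : Measure Ω}
    [IsProbabilityMeasure p] [IsProbabilityMeasure q] (hp : IsNonatomic p)
    (h : ∀ E F, MeasurableSet E → MeasurableSet F → (p.real E ≤ p.real F ↔ q.real E ≤ q.real F)) :
    p = q := by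
  have hex : ∀ a : ℝ, ∃ E, MeasurableSet E ∧ (0 ≤ a → a ≤ 1 → p.real E = a) := fun a => by
    by_cases ha : 0 ≤ a ∧ a ≤ 1
    · obtain ⟨E, hE, -, he⟩ := hp.exists_subset_real_eq MeasurableSet.univ ha.1 (by simpa using ha.2)
      exact ⟨E, hE, fun _ _ => he⟩
    · exact ⟨∅, MeasurableSet.empty, fun h0 h1 => absurd ⟨h0, h1⟩ ha⟩
  choose A hA hpA using hex
  -- Hence `q` is a function of `p`, namely `a ↦ q.real (A a)`; this function is monotone and
  -- additive, so it is the identity.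
  have heq : ∀ E F, MeasurableSet E → MeasurableSet F → p.real E = p.real F →
      q.real E = q.real F := fun E F hE hF he =>
    le_antisymm ((h E F hE hF).1 he.le) ((h F E hF hE).1 he.ge)
  have hφ : ∀ E, MeasurableSet E → q.real (A (p.real E)) = q.real E := fun E hE =>
    heq _ _ (hA _) hE (hpA _ measureReal_nonneg measureReal_le_one)
  have hid : ∀ a : ℝ, 0 ≤ a → a ≤ 1 → q.real (A a) = a := fun a h0 h1 => by
    refine eq_self_of_additive_on_unit (φ := fun a => q.real (A a)) ?_ ?_ ?_ h0 h1
    · intro a b ha hab hb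
      refine (h _ _ (hA _) (hA _)).1 ?_
      rwa [hpA _ ha (hab.trans hb), hpA _ (ha.trans hab) hb]
    · intro a b ha hb hab
      obtain ⟨F, hF, hFE, hFa⟩ := hp.exists_subset_real_eq (hA (a + b)) ha
        (by rw [hpA _ (by linarith) hab]; linarith)
      have hd : p.real (A (a + b) \ F) = b := by
        rw [measureReal_sdiff hFE hF, hpA _ (by linarith) hab, hFa]; ring
      have hq : q.real (A (a + b) \ F) = q.real (A (a + b)) - q.real F := measureReal_sdiff hFE hF
      have e1 := hφ F hF
      have e2 := hφ _ ((hA (a + b)).diff hF)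
      rw [hFa] at e1
      rw [hd] at e2
      linarith
    · have := hφ Set.univ MeasurableSet.univ
      simpa using this
  refine Measure.ext fun E hE => ?_
  have e := hφ E hE
  rw [hid _ measureReal_nonneg measureReal_le_one] at e
  exact (measureReal_eq_measureReal_iff).1 e

/-! ### Simple acts and expected utility -/

namespace Act

variable {Ω : Type*} [MeasurableSpace Ω] {𝕏 : Type*} {X : Menu 𝕏}

/-- An act as a simple function. -/
def toSimpleFunc (f : Act Ω X) : SimpleFunc Ω X.carrier where
  toFun := f.toFun
  measurableSet_fiber' := f.measurable_fibre
  finite_range' := f.finite_range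

theorem integrable (f : Act Ω X) (u : X.carrier → ℝ) (p : Measure Ω) [IsFiniteMeasure p] :
    Integrable (fun ω => u (f.toFun ω)) p :=
  (f.toSimpleFunc.map u).integrable_of_isFiniteMeasure

open Classical in
/-- The act that coincides with `f` on the event `E` and with `g` elsewhere. -/
def splice {E : Set Ω} (hE : MeasurableSet E) (f g : Act Ω X) : Act Ω X where
  toFun := (f.toSimpleFunc.piecewise E hE g.toSimpleFunc)
  finite_range := SimpleFunc.finite_range _
  measurable_fibre := SimpleFunc.measurableSet_fiber _

theorem splice_of_mem {E : Set Ω} (hE : MeasurableSet E) (f g : Act Ω X) {ω : Ω} (h : ω ∈ E) :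
    (splice hE f g).toFun ω = f.toFun ω := by
  simp [splice, toSimpleFunc, h]

theorem splice_of_notMem {E : Set Ω} (hE : MeasurableSet E) (f g : Act Ω X) {ω : Ω}
    (h : ω ∉ E) : (splice hE f g).toFun ω = g.toFun ω := by
  simp [splice, toSimpleFunc, h]

end Act

section SEU

variable {Ω : Type*} [MeasurableSpace Ω] {𝕏 : Type*} {X : Menu 𝕏}

theorem seu_const (u : X.carrier → ℝ) (p : Measure Ω) [IsProbabilityMeasure p] (x : X.carrier) :
    seu u p (Act.const x) = u x := by
  simp [seu, Act.const]

theorem seu_incl {X' : Menu 𝕏} (h : X.carrier ⊆ X'.carrier) (u : X'.carrier → ℝ) (p : Measure Ω)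
    (f : Act Ω X) : seu u p (f.incl h) = seu (fun x => u (Set.inclusion h x)) p f := rfl

theorem seu_bet (u : X.carrier → ℝ) (p : Measure Ω) [IsProbabilityMeasure p] {E : Set Ω}
    (hE : MeasurableSet E) (x y : X.carrier) :
    seu u p (Act.splice hE (Act.const x) (Act.const y)) =
      p.real E * u x + (1 - p.real E) * u y := by
  have : ∀ ω, u ((Act.splice hE (Act.const x) (Act.const y)).toFun ω) =
      u y + E.indicator (fun _ => u x - u y) ω := fun ω => by
    by_cases h : ω ∈ E
    · simp [Act.splice_of_mem hE _ _ h, h, Act.const]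
    · simp [Act.splice_of_notMem hE _ _ h, h, Act.const]
  simp only [seu, this]
  rw [integral_add (integrable_const _) ((integrable_const _).indicator hE),
    integral_indicator_const _ hE]
  simp
  ring

theorem seu_eq_sum (u : X.carrier → ℝ) (p : Measure Ω) [IsProbabilityMeasure p] (f : Act Ω X)
    (S : Finset X.carrier) (hS : ∀ ω, f.toFun ω ∈ S) :
    seu u p f = ∑ x ∈ S, p.real (f.toFun ⁻¹' {x}) * u x := by
  have : ∀ ω, u (f.toFun ω) = ∑ x ∈ S, (f.toFun ⁻¹' {x}).indicator (fun _ => u x) ω := fun ω => by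
    rw [Finset.sum_eq_single (f.toFun ω)]
    · simp
    · intro y _ hy
      exact Set.indicator_of_notMem (by simpa using hy.symm) _
    · exact fun h => absurd (hS ω) h
  simp only [seu, this]
  rw [integral_finsetSum _ fun x _ => (integrable_const _).indicator (f.measurable_fibre x)]
  refine Finset.sum_congr rfl fun x _ => ?_
  rw [integral_indicator_const _ (f.measurable_fibre x), smul_eq_mul]

theorem seu_affine (u : X.carrier → ℝ) (p : Measure Ω) [IsProbabilityMeasure p] (f : Act Ω X)
    (m d : ℝ) : seu (fun x => (u x - m) / d) p f = (seu u p f - m) / d := by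
  simp only [seu]
  rw [integral_div, integral_sub (f.integrable u p) (integrable_const _)]
  simp

/-- Expected utility is a finite sum over outcomes. Mixing scales every term by `α`, and the term of
`x` alone gains `(1 - α) * u x`. -/
theorem seu_pseudoMix (u : X.carrier → ℝ) (p : Measure Ω) [IsProbabilityMeasure p] {α : ℝ}
    {f h : Act Ω X} {x : X.carrier}
    (hx : p.real (h.toFun ⁻¹' {x}) = α * p.real (f.toFun ⁻¹' {x}) + (1 - α))
    (hy : ∀ y, y ≠ x → p.real (h.toFun ⁻¹' {y}) = α * p.real (f.toFun ⁻¹' {y})) :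
    seu u p h = α * seu u p f + (1 - α) * u x := by
  classical
  set S : Finset X.carrier := insert x (f.finite_range.toFinset ∪ h.finite_range.toFinset)
  rw [seu_eq_sum u p f S (fun ω => by simp [S]), seu_eq_sum u p h S (fun ω => by simp [S])]
  have hxS : x ∈ S := by simp [S]
  rw [← Finset.add_sum_erase _ _ hxS, ← Finset.add_sum_erase S (fun x => _ * u x) hxS, hx,
    Finset.sum_congr rfl fun y hyS => by rw [hy y (Finset.ne_of_mem_erase hyS)], mul_add,
    Finset.mul_sum]
  simp only [mul_assoc]
  ring

theorem IsSEURep.affine {R : Act Ω X → Act Ω X → Prop} {u : X.carrier → ℝ} {p : Measure Ω}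
    (h : IsSEURep R u p) (m : ℝ) {d : ℝ} (hd : 0 < d) :
    IsSEURep R (fun x => (u x - m) / d) p := by
  have := h.belief.1
  refine ⟨?_, ?_, h.belief, fun f g => ?_⟩
  · obtain ⟨x, y, hxy⟩ := h.nonconstant
    refine ⟨x, y, fun he => hxy ?_⟩
    field_simp at he
    linarith
  · obtain ⟨C, hC⟩ := h.bounded
    refine ⟨(C + |m|) / d, fun x => ?_⟩
    rw [abs_div, abs_of_pos hd]
    gcongr
    exact (abs_sub _ _).trans (by linarith [hC x])
  · rw [h.represents, seu_affine, seu_affine, ge_iff_le, ge_iff_le, div_le_div_iff_of_pos_right hd,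
      sub_le_sub_iff_right]

/-- Uniqueness of the normalized SEU representation. -/
theorem IsSEURep.unique {R : Act Ω X → Act Ω X → Prop} {u v : X.carrier → ℝ} {p q : Measure Ω}
    (hu : IsSEURep R u p) (hv : IsSEURep R v q)
    (hu01 : ∀ x, 0 ≤ u x ∧ u x ≤ 1) (hv01 : ∀ x, 0 ≤ v x ∧ v x ≤ 1)
    (hu1 : ∃ b, u b = 1) (hu0 : ∃ w, u w = 0) (hv1 : ∃ b, v b = 1) (hv0 : ∃ w, v w = 0) :
    u = v ∧ p = q := by
  have := hu.belief.1
  have := hv.belief.1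
  have hc : ∀ x y, u y ≤ u x ↔ v y ≤ v x := fun x y => by
    have h1 := hu.represents (Act.const x) (Act.const y)
    have h2 := hv.represents (Act.const x) (Act.const y)
    rw [seu_const, seu_const] at h1 h2
    exact h1.symm.trans h2
  obtain ⟨b, hb⟩ := hu1
  obtain ⟨w, hw⟩ := hu0
  have hvb : v b = 1 := by
    obtain ⟨b', hb'⟩ := hv1
    have := (hc b b').1 (by rw [hb]; exact (hu01 b').2)
    exact le_antisymm (hv01 b).2 (by linarith)
  have hvw : v w = 0 := by
    obtain ⟨w', hw'⟩ := hv0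
    have := (hc w' w).1 (by rw [hw]; exact (hu01 w').1)
    exact le_antisymm (by linarith) (hv01 w).1
  -- A bet with prizes `b` and `w` has expected utility equal to the probability of its event, so
  -- both beliefs order events as `R` orders bets.
  have hpq : p = q := by
    refine belief_eq_of_same_order hu.belief.2 fun E F hE hF => ?_
    have h1 := hu.represents (Act.splice hF (Act.const b) (Act.const w))
      (Act.splice hE (Act.const b) (Act.const w))
    have h2 := hv.represents (Act.splice hF (Act.const b) (Act.const w))
      (Act.splice hE (Act.const b) (Act.const w))
    rw [seu_bet, seu_bet] at h1 h2
    simp only [hb, hw, hvb, hvw, mul_one, mul_zero, add_zero] at h1 h2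
    exact h1.symm.trans h2
  subst hpq
  refine ⟨funext fun x => ?_, rfl⟩
  -- The bet on an event of probability `u x` is indifferent to `x`, and `v` must respect this
  -- indifference.
  obtain ⟨E, hE, -, he⟩ := hu.belief.2.exists_subset_real_eq MeasurableSet.univ (hu01 x).1
    (by simpa using (hu01 x).2)
  have h1 := hu.represents (Act.splice hE (Act.const b) (Act.const w)) (Act.const x)
  have h2 := hv.represents (Act.splice hE (Act.const b) (Act.const w)) (Act.const x)
  have h3 := hu.represents (Act.const x) (Act.splice hE (Act.const b) (Act.const w))
  have h4 := hv.represents (Act.const x) (Act.splice hE (Act.const b) (Act.const w))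
  rw [seu_bet, seu_const] at h1 h2 h3 h4
  simp only [hb, hw, hvb, hvw, mul_one, mul_zero, add_zero, he] at h1 h2 h3 h4
  exact le_antisymm (h4.1 (h3.2 le_rfl)) (h2.1 (h1.2 le_rfl))

/-! ### Normalized representations of a profile -/

namespace Profile

variable {n : ℕ} (P : Profile Ω X n)

instance (i : Fin n) : IsProbabilityMeasure (P.belief i) := (P.isSEURep i).belief.1

theorem pref_const_iff (i : Fin n) (x y : X.carrier) :
    P.pref i (Act.const x) (Act.const y) ↔ P.value i y ≤ P.value i x := by
  rw [(P.isSEURep i).represents, seu_const, seu_const]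

theorem exists_value_iSup (i : Fin n) : ∃ b, P.value i b = ⨆ y, P.value i y := by
  obtain ⟨b, hb⟩ := P.exists_best i
  simp only [pref_const_iff] at hb
  have : Nonempty X.carrier := ⟨b⟩
  exact ⟨b, le_antisymm (le_ciSup ⟨_, by rintro _ ⟨y, rfl⟩; exact hb y⟩ b) (ciSup_le hb)⟩

theorem exists_value_iInf (i : Fin n) : ∃ w, P.value i w = ⨅ y, P.value i y := by
  obtain ⟨w, hw⟩ := P.exists_worst i
  simp only [pref_const_iff] at hw
  have : Nonempty X.carrier := ⟨w⟩
  exact ⟨w, le_antisymm (le_ciInf hw) (ciInf_le ⟨_, by rintro _ ⟨y, rfl⟩; exact hw y⟩ w)⟩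

theorem iInf_value_lt_iSup_value (i : Fin n) : ⨅ y, P.value i y < ⨆ y, P.value i y := by
  obtain ⟨C, hC⟩ := (P.isSEURep i).bounded
  have ha : BddAbove (Set.range (P.value i)) :=
    ⟨C, by rintro _ ⟨y, rfl⟩; exact (abs_le.1 (hC y)).2⟩
  have hb : BddBelow (Set.range (P.value i)) :=
    ⟨-C, by rintro _ ⟨y, rfl⟩; exact (abs_le.1 (hC y)).1⟩
  obtain ⟨x, y, hxy⟩ := (P.isSEURep i).nonconstant
  rcases hxy.lt_or_gt with h | h
  · exact (ciInf_le hb x).trans_lt (h.trans_le (le_ciSup ha y))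
  · exact (ciInf_le hb y).trans_lt (h.trans_le (le_ciSup ha x))

theorem exists_normValue_eq_one (i : Fin n) : ∃ b, P.normValue i b = 1 := by
  obtain ⟨b, hb⟩ := P.exists_value_iSup i
  refine ⟨b, ?_⟩
  rw [normValue, hb]
  exact div_self (sub_pos.2 (P.iInf_value_lt_iSup_value i)).ne'

theorem exists_normValue_eq_zero (i : Fin n) : ∃ w, P.normValue i w = 0 := by
  obtain ⟨w, hw⟩ := P.exists_value_iInf i
  exact ⟨w, by simp [normValue, hw]⟩

theorem isSEURep_normValue (i : Fin n) : IsSEURep (P.pref i) (P.normValue i) (P.belief i) :=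
  (P.isSEURep i).affine _ (sub_pos.2 (P.iInf_value_lt_iSup_value i))

/-- `value` and `belief` come from a choice; this is the way to identify `normValue` and `belief`
with given data. -/
theorem eq_of_isSEURep {i : Fin n} {v : X.carrier → ℝ} {q : Measure Ω}
    (h : IsSEURep (P.pref i) v q) (h01 : ∀ x, 0 ≤ v x ∧ v x ≤ 1) (h1 : ∃ b, v b = 1)
    (h0 : ∃ w, v w = 0) : P.normValue i = v ∧ P.belief i = q :=
  (P.isSEURep_normValue i).unique h (P.normValue_mem i) h01 (P.exists_normValue_eq_one i)
    (P.exists_normValue_eq_zero i) h1 h0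

theorem pref_iff (i : Fin n) (f g : Act Ω X) :
    P.pref i f g ↔ P.normUtil g i ≤ P.normUtil f i :=
  (P.isSEURep_normValue i).represents f g

theorem normUtil_const (x : X.carrier) (i : Fin n) :
    P.normUtil (Act.const x) i = P.normValue i x :=
  seu_const _ _ _

/-- The problem with given normalized value functions and beliefs. -/
def ofValues (v : Fin n → X.carrier → ℝ) (p : Fin n → Measure Ω)
    (h01 : ∀ i x, 0 ≤ v i x ∧ v i x ≤ 1) (h1 : ∀ i, ∃ b, v i b = 1) (h0 : ∀ i, ∃ w, v i w = 0)
    (hp : ∀ i, IsBelief (p i)) : Profile Ω X n where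
  pref i f g := seu (v i) (p i) f ≥ seu (v i) (p i) g
  isSEU i := by
    obtain ⟨b, hb⟩ := h1 i
    obtain ⟨w, hw⟩ := h0 i
    exact ⟨v i, p i, ⟨b, w, by simp [hb, hw]⟩,
      ⟨1, fun x => abs_le.2 ⟨by linarith [(h01 i x).1], (h01 i x).2⟩⟩, hp i, fun _ _ => Iff.rfl⟩
  exists_best i := by
    obtain ⟨b, hb⟩ := h1 i
    have := (hp i).1
    exact ⟨b, fun x => by rw [seu_const, seu_const, hb]; exact (h01 i x).2⟩
  exists_worst i := by
    obtain ⟨w, hw⟩ := h0 i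
    have := (hp i).1
    exact ⟨w, fun x => by rw [seu_const, seu_const, hw]; exact (h01 i x).1⟩

section ofValues

variable {v : Fin n → X.carrier → ℝ} {p : Fin n → Measure Ω}
    (h01 : ∀ i x, 0 ≤ v i x ∧ v i x ≤ 1) (h1 : ∀ i, ∃ b, v i b = 1) (h0 : ∀ i, ∃ w, v i w = 0)
    (hp : ∀ i, IsBelief (p i))

theorem ofValues_eq (i : Fin n) : (ofValues v p h01 h1 h0 hp).normValue i = v i ∧
    (ofValues v p h01 h1 h0 hp).belief i = p i := by
  refine eq_of_isSEURep _ ?_ (h01 i) (h1 i) (h0 i)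
  obtain ⟨b, hb⟩ := h1 i
  obtain ⟨w, hw⟩ := h0 i
  exact ⟨⟨b, w, by simp [hb, hw]⟩,
      ⟨1, fun x => abs_le.2 ⟨by linarith [(h01 i x).1], (h01 i x).2⟩⟩, hp i, fun _ _ => Iff.rfl⟩

theorem normValue_ofValues (i : Fin n) (x : X.carrier) :
    (ofValues v p h01 h1 h0 hp).normValue i x = v i x :=
  congrFun (ofValues_eq h01 h1 h0 hp i).1 x

theorem belief_ofValues (i : Fin n) : (ofValues v p h01 h1 h0 hp).belief i = p i :=
  (ofValues_eq h01 h1 h0 hp i).2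

end ofValues

theorem normUtil_incl {P : Profile Ω X n} {X' : Menu 𝕏} {P' : Profile Ω X' n} (h : X.carrier ⊆ X'.carrier)
    (hv : ∀ i x, P'.normValue i (Set.inclusion h x) = P.normValue i x)
    (hb : ∀ i, P'.belief i = P.belief i) (f : Act Ω X) :
    P'.normUtil (f.incl h) = P.normUtil f := by
  funext i
  simp only [normUtil, seu_incl, hv, hb]

theorem isInessentialExpansion_of_normValue {P : Profile Ω X n} {X' : Menu 𝕏} {P' : Profile Ω X' n}
    (h : X.carrier ⊆ X'.carrier)
    (hv : ∀ i x, P'.normValue i (Set.inclusion h x) = P.normValue i x)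
    (hb : ∀ i, P'.belief i = P.belief i) : P.IsInessentialExpansion P' := by
  refine ⟨h, fun i f g => ?_, fun x' i => ?_⟩
  · rw [pref_iff, pref_iff, normUtil_incl h hv hb, normUtil_incl h hv hb]
  · obtain ⟨b, hb⟩ := P.exists_normValue_eq_one i
    obtain ⟨w, hw⟩ := P.exists_normValue_eq_zero i
    refine ⟨b, w, ?_, ?_⟩ <;> rw [pref_iff, normUtil_const, normUtil_const, hv]
    · rw [hb]; exact (P'.normValue_mem i x').2
    · rw [hw]; exact (P'.normValue_mem i x').1

/-- Since `X` already bounds all of `X'` in every preference, the values of `P'` restricted to `X`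
still attain 0 and 1. They are thus a normalized representation of `P`, and uniqueness applies. -/
theorem IsInessentialExpansion.normUtil_incl {P : Profile Ω X n} {X' : Menu 𝕏} {P' : Profile Ω X' n}
    (hI : P.IsInessentialExpansion P') (h : X.carrier ⊆ X'.carrier) (f : Act Ω X) :
    P'.normUtil (f.incl h) = P.normUtil f := by
  obtain ⟨_, hpref, hext⟩ := hI
  have key : ∀ i, P.normValue i = (fun x => P'.normValue i (Set.inclusion h x)) ∧
      P.belief i = P'.belief i := fun i => by
    have hone : ∃ b : X.carrier, P'.normValue i (Set.inclusion h b) = 1 := by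
      obtain ⟨b', hb'⟩ := P'.exists_normValue_eq_one i
      obtain ⟨xp, _, hxp, _⟩ := hext b' i
      rw [pref_iff, normUtil_const, normUtil_const, hb'] at hxp
      exact ⟨xp, le_antisymm (P'.normValue_mem i _).2 hxp⟩
    have hzero : ∃ w : X.carrier, P'.normValue i (Set.inclusion h w) = 0 := by
      obtain ⟨w', hw'⟩ := P'.exists_normValue_eq_zero i
      obtain ⟨_, xm, _, hxm⟩ := hext w' i
      rw [pref_iff, normUtil_const, normUtil_const, hw'] at hxm
      exact ⟨xm, le_antisymm hxm (P'.normValue_mem i _).1⟩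
    refine P.eq_of_isSEURep ⟨?_, ?_, (P'.isSEURep i).belief, fun f g => ?_⟩
      (fun x => P'.normValue_mem i _) hone hzero
    · obtain ⟨b, hb⟩ := hone
      obtain ⟨w, hw⟩ := hzero
      exact ⟨b, w, by simp [hb, hw]⟩
    · exact ⟨1, fun x => abs_le.2
        ⟨by linarith [(P'.normValue_mem i (Set.inclusion h x)).1], (P'.normValue_mem i _).2⟩⟩
    · rw [← hpref, (P'.isSEURep_normValue i).represents, seu_incl, seu_incl]
  exact Profile.normUtil_incl h (fun i x => (congrFun (key i).1 x).symm)
    (fun i => (key i).2.symm) f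

end Profile

end SEU

/-! ### Welfarism: only utility vectors matter -/

section Welfarism

variable {Ω : Type*} [MeasurableSpace Ω] {𝕏 : Type*} {n : ℕ}

/-- An act as an act over a smaller menu that contains its range. -/
def Act.codRestrict {X X' : Menu 𝕏} (f : Act Ω X') (hf : ∀ ω, (f.toFun ω : 𝕏) ∈ X.carrier) :
    Act Ω X where
  toFun ω := ⟨f.toFun ω, hf ω⟩
  finite_range := by
    refine Set.Finite.of_finite_image (f := Subtype.val)
      ((f.finite_range.image Subtype.val).subset ?_) Subtype.val_injective.injOn
    rintro _ ⟨_, ⟨ω, rfl⟩, rfl⟩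
    exact ⟨_, ⟨ω, rfl⟩, rfl⟩
  measurable_fibre x := by
    by_cases hx : (x : 𝕏) ∈ X'.carrier
    · convert f.measurable_fibre ⟨x, hx⟩ using 1
      ext ω
      simp [Subtype.ext_iff]
    · convert MeasurableSet.empty using 1
      ext ω
      simp only [Set.mem_preimage, Set.mem_singleton_iff, Set.mem_empty_iff_false, iff_false]
      rintro rfl
      exact hx (f.toFun ω).2

theorem Act.incl_codRestrict {X X' : Menu 𝕏} (h : X.carrier ⊆ X'.carrier) (f : Act Ω X')
    (hf : ∀ ω, (f.toFun ω : 𝕏) ∈ X.carrier) : (f.codRestrict hf).incl h = f := rfl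

/-- The menu of `P` may exhaust `𝕏`; a finite submenu leaves room for fresh outcomes. Keeping a best
and a worst outcome of each individual preserves the normalization. -/
theorem Profile.exists_finite_menu [Nonempty (Fin n)] {X : Menu 𝕏} (P : Profile Ω X n)
    (f g : Act Ω X) :
    ∃ X₀ : Menu 𝕏, X₀.carrier.Finite ∧ X₀.carrier ⊆ X.carrier ∧
      (∀ ω, (f.toFun ω : 𝕏) ∈ X₀.carrier) ∧ (∀ ω, (g.toFun ω : 𝕏) ∈ X₀.carrier) ∧
      (∀ i, ∃ b : X.carrier, (b : 𝕏) ∈ X₀.carrier ∧ P.normValue i b = 1) ∧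
      (∀ i, ∃ w : X.carrier, (w : 𝕏) ∈ X₀.carrier ∧ P.normValue i w = 0) := by
  choose b hb using P.exists_normValue_eq_one
  choose w hw using P.exists_normValue_eq_zero
  set T : Set X.carrier := Set.range f.toFun ∪ Set.range g.toFun ∪ Set.range b ∪ Set.range w
  have hT : T.Finite :=
    ((f.finite_range.union g.finite_range).union (Set.finite_range b)).union (Set.finite_range w)
  have hbT : ∀ i, b i ∈ T := fun i => Or.inl (Or.inr ⟨i, rfl⟩)
  have hwT : ∀ i, w i ∈ T := fun i => Or.inr ⟨i, rfl⟩
  have hT' := hT.image Subtype.val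
  refine ⟨⟨Subtype.val '' T, hT'.countable, ?_⟩, hT', ?_, ?_, ?_, ?_, ?_⟩
  · obtain ⟨i⟩ := ‹Nonempty (Fin n)›
    refine ⟨b i, ⟨_, hbT i, rfl⟩, w i, ⟨_, hwT i, rfl⟩, fun h => ?_⟩
    have h1 := hb i
    rw [Subtype.ext h, hw i] at h1
    exact zero_ne_one h1
  · rintro _ ⟨x, -, rfl⟩
    exact x.2
  · exact fun ω => ⟨_, Or.inl (Or.inl (Or.inl ⟨ω, rfl⟩)), rfl⟩
  · exact fun ω => ⟨_, Or.inl (Or.inl (Or.inr ⟨ω, rfl⟩)), rfl⟩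
  · exact fun i => ⟨b i, ⟨_, hbT i, rfl⟩, hb i⟩
  · exact fun i => ⟨w i, ⟨_, hwT i, rfl⟩, hw i⟩

/-- Two problems over disjoint menus, with the beliefs of the first, have a common inessential
expansion. -/
theorem Profile.exists_common_expansion {X Z : Menu 𝕏} (P : Profile Ω X n) (Q : Profile Ω Z n)
    (hbel : ∀ i, Q.belief i = P.belief i) (hdisj : Disjoint X.carrier Z.carrier) :
    ∃ (Y : Menu 𝕏) (hX : X.carrier ⊆ Y.carrier) (hZ : Z.carrier ⊆ Y.carrier) (S : Profile Ω Y n),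
      P.IsInessentialExpansion S ∧ Q.IsInessentialExpansion S ∧
      (∀ f, S.normUtil (f.incl hX) = P.normUtil f) ∧
      (∀ f, S.normUtil (f.incl hZ) = Q.normUtil f) := by
  classical
  let Y : Menu 𝕏 := ⟨X.carrier ∪ Z.carrier, X.countable.union Z.countable,
    X.nontrivial.mono Set.subset_union_left⟩
  have hX : X.carrier ⊆ Y.carrier := Set.subset_union_left
  have hZ : Z.carrier ⊆ Y.carrier := Set.subset_union_right
  let v : Fin n → Y.carrier → ℝ := fun i y =>
    if h : (y : 𝕏) ∈ X.carrier then P.normValue i ⟨y, h⟩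
    else if h' : (y : 𝕏) ∈ Z.carrier then Q.normValue i ⟨y, h'⟩ else 0
  have hvX : ∀ i x, v i (Set.inclusion hX x) = P.normValue i x := fun i x => by simp [v]
  have hvZ : ∀ i z, v i (Set.inclusion hZ z) = Q.normValue i z := fun i z => by
    have : (z : 𝕏) ∉ X.carrier := fun h => Set.disjoint_left.1 hdisj h z.2
    simp [v, this]
  have h01 : ∀ i y, 0 ≤ v i y ∧ v i y ≤ 1 := fun i y => by
    rcases y.2 with h | h
    · have := P.normValue_mem i ⟨y, h⟩
      rwa [← hvX] at this
    · have := Q.normValue_mem i ⟨y, h⟩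
      rwa [← hvZ] at this
  have h1 : ∀ i, ∃ b, v i b = 1 := fun i => by
    obtain ⟨b, hb⟩ := P.exists_normValue_eq_one i
    exact ⟨_, (hvX i b).trans hb⟩
  have h0 : ∀ i, ∃ w, v i w = 0 := fun i => by
    obtain ⟨w, hw⟩ := P.exists_normValue_eq_zero i
    exact ⟨_, (hvX i w).trans hw⟩
  let S := Profile.ofValues v P.belief h01 h1 h0 fun i => (P.isSEURep i).belief
  have hSX : ∀ i x, S.normValue i (Set.inclusion hX x) = P.normValue i x := fun i x =>
    (Profile.normValue_ofValues ..).trans (hvX i x)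
  have hSZ : ∀ i z, S.normValue i (Set.inclusion hZ z) = Q.normValue i z := fun i z =>
    (Profile.normValue_ofValues ..).trans (hvZ i z)
  have hSb : ∀ i, S.belief i = P.belief i := fun i => Profile.belief_ofValues ..
  have hSb' : ∀ i, S.belief i = Q.belief i := fun i => (hSb i).trans (hbel i).symm
  exact ⟨Y, hX, hZ, S, Profile.isInessentialExpansion_of_normValue hX hSX hSb,
    Profile.isInessentialExpansion_of_normValue hZ hSZ hSb',
    Profile.normUtil_incl hX hSX hSb, Profile.normUtil_incl hZ hSZ hSb'⟩

theorem exists_injective_seq_avoiding [Infinite 𝕏] {S : Set 𝕏} (hS : S.Finite) :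
    ∃ e : ℕ → 𝕏, Function.Injective e ∧ ∀ k, e k ∉ S := by
  have := hS.infinite_compl
  exact ⟨fun k => this.natEmbedding _ k,
    Subtype.val_injective.comp (this.natEmbedding _).injective,
    fun k => (this.natEmbedding _ k).2⟩

/-- Every sequence of points of the cube that starts with `0` and `1` consists of the utility
vectors of the outcomes in a problem with given beliefs. -/
theorem Profile.exists_of_seq {e : ℕ → 𝕏} (he : Function.Injective e) {v : ℕ → Fin n → ℝ}
    (hv : ∀ k, v k ∈ cube n) (hv0 : v 0 = 0) (hv1 : v 1 = 1) {p : Fin n → Measure Ω}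
    (hp : ∀ i, IsBelief (p i)) :
    ∃ (Z : Menu 𝕏) (Q : Profile Ω Z n) (a : ℕ ≃ Z.carrier), Z.carrier = Set.range e ∧
      (∀ k i, Q.normValue i (a k) = v k i) ∧ ∀ i, Q.belief i = p i := by
  let Z : Menu 𝕏 := ⟨Set.range e, Set.countable_range e,
    ⟨e 0, ⟨0, rfl⟩, e 1, ⟨1, rfl⟩, fun h => zero_ne_one (he h)⟩⟩
  let a : ℕ ≃ Z.carrier := Equiv.ofInjective e he
  refine ⟨Z, Profile.ofValues (fun i z => v (a.symm z) i) p (fun i z => hv _ i)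
    (fun i => ⟨a 1, by simp [hv1]⟩) (fun i => ⟨a 0, by simp [hv0]⟩) hp, a, rfl, fun k i => ?_,
    fun i => Profile.belief_ofValues ..⟩
  rw [Profile.normValue_ofValues]
  simp

/-- Every sequence of points of the cube consists of utility vectors of outcomes in a problem. -/
theorem Profile.exists_of_seq_cube {e : ℕ → 𝕏} (he : Function.Injective e) {s : ℕ → Fin n → ℝ}
    (hs : ∀ k, s k ∈ cube n) {p : Measure Ω} (hp : IsBelief p) :
    ∃ (Z : Menu 𝕏) (Q : Profile Ω Z n) (a : ℕ → Z.carrier), Z.carrier = Set.range e ∧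
      ∀ k, Q.normUtil (Act.const (a k)) = s k := by
  -- Two additional outcomes, worst and best for everybody, make the prescribed values normalized.
  let v : ℕ → Fin n → ℝ := fun k => match k with
    | 0 => 0
    | 1 => 1
    | k + 2 => s k
  have hv : ∀ k, v k ∈ cube n := fun k => match k with
    | 0 => fun i => by simp [v]
    | 1 => fun i => by simp [v]
    | k + 2 => hs k
  obtain ⟨Z, Q, a, hZ, ha, -⟩ := Profile.exists_of_seq he hv rfl rfl (p := fun _ => p) fun _ => hp
  refine ⟨Z, Q, fun k => a (k + 2), hZ, fun k => funext fun i => ?_⟩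
  rw [Profile.normUtil_const, ha]

namespace AggregationRule

variable {R : AggregationRule Ω 𝕏 n}

theorem Pareto.rel_of_le (hR : R.Pareto) {X : Menu 𝕏} {P : Profile Ω X n} {f g : Act Ω X}
    (h : P.normUtil g ≤ P.normUtil f) : R.rel X P f g :=
  (hR X P f g).1 fun i => (P.pref_iff i f g).2 (h i)

theorem Pareto.rel_congr (hR : R.Pareto) {X : Menu 𝕏} {P : Profile Ω X n} {f f' g g' : Act Ω X}
    (hf : P.normUtil f = P.normUtil f') (hg : P.normUtil g = P.normUtil g') :
    R.rel X P f g ↔ R.rel X P f' g' :=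
  ⟨fun h => R.transitive _ _ _ _ _ (hR.rel_of_le hf.le)
    (R.transitive _ _ _ _ _ h (hR.rel_of_le hg.ge)),
   fun h => R.transitive _ _ _ _ _ (hR.rel_of_le hf.ge)
    (R.transitive _ _ _ _ _ h (hR.rel_of_le hg.le))⟩

/-- Acts are ranked like outcomes with the same utility vectors in any problem without outcomes
from some finite set. -/
theorem rel_iff_rel_const [Nonempty (Fin n)] (hPar : R.Pareto) (hIIE : R.IIE)
    (hBI : R.BeliefIrrelevance) {X : Menu 𝕏} (P : Profile Ω X n) (f g : Act Ω X) :
    ∃ S : Set 𝕏, S.Finite ∧ ∀ (Z : Menu 𝕏) (Q : Profile Ω Z n), Disjoint S Z.carrier →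
      ∀ c d : Z.carrier, Q.normUtil (Act.const c) = P.normUtil f →
        Q.normUtil (Act.const d) = P.normUtil g →
        (R.rel X P f g ↔ R.rel Z Q (Act.const c) (Act.const d)) := by
  obtain ⟨X₀, hfin, hsub, hf, hg, hbest, hworst⟩ := P.exists_finite_menu f g
  refine ⟨X₀.carrier, hfin, fun Z Q hdisj c d hc hd => ?_⟩
  let P₀ : Profile Ω X₀ n := Profile.ofValues (fun i x => P.normValue i (Set.inclusion hsub x))
    P.belief (fun i x => P.normValue_mem i _)
    (fun i => by obtain ⟨b, h, hb⟩ := hbest i; exact ⟨⟨b, h⟩, hb⟩)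
    (fun i => by obtain ⟨w, h, hw⟩ := hworst i; exact ⟨⟨w, h⟩, hw⟩)
    fun i => (P.isSEURep i).belief
  have hv₀ : ∀ i x, P.normValue i (Set.inclusion hsub x) = P₀.normValue i x := fun i x => by
    simp only [P₀, Profile.normValue_ofValues]
  have hb₀ : ∀ i, P.belief i = P₀.belief i := fun i => (Profile.belief_ofValues ..).symm
  -- A common expansion needs common beliefs. Only outcomes are compared in `Q`, so belief
  -- irrelevance permits the beliefs of `P` in their place.
  let Q' : Profile Ω Z n := Profile.ofValues Q.normValue P.belief Q.normValue_mem
    Q.exists_normValue_eq_one Q.exists_normValue_eq_zero fun i => (P.isSEURep i).belief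
  have hvQ : ∀ i x, Q'.normValue i x = Q.normValue i x := fun i x => Profile.normValue_ofValues ..
  have hbQ : ∀ i, Q'.belief i = P₀.belief i := fun i =>
    (Profile.belief_ofValues ..).trans (hb₀ i)
  have hQ' : ∀ z, Q'.normUtil (Act.const z) = Q.normUtil (Act.const z) := fun z => funext fun i => by
    rw [Profile.normUtil_const, Profile.normUtil_const, hvQ]
  obtain ⟨Y, hX, hZ, S, hS₀, hSQ, hU₀, hUQ⟩ := P₀.exists_common_expansion Q' hbQ hdisj
  have hu : ∀ h : Act Ω X₀, P₀.normUtil h = P.normUtil (h.incl hsub) := fun h =>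
    (Profile.normUtil_incl hsub hv₀ hb₀ h).symm
  -- Both sides are transported to the common expansion `S`, the left one by way of `P₀`; there
  -- Pareto indifference exchanges the acts for the outcomes.
  rw [← hBI Z Q' Q hvQ, ← hIIE _ _ _ _ hSQ hZ, ← Act.incl_codRestrict hsub f hf,
    ← Act.incl_codRestrict hsub g hg,
    hIIE _ _ _ _ (Profile.isInessentialExpansion_of_normValue hsub hv₀ hb₀) hsub,
    ← hIIE _ _ _ _ hS₀ hX]
  apply hPar.rel_congr
  · rw [hU₀, hUQ, hu, hQ', hc]; rfl
  · rw [hU₀, hUQ, hu, hQ', hd]; rfl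

/-- The relation between utility vectors that underlies an aggregation rule. -/
def utilRel (R : AggregationRule Ω 𝕏 n) (u v : Fin n → ℝ) : Prop :=
  ∃ (X : Menu 𝕏) (P : Profile Ω X n) (f g : Act Ω X),
    P.normUtil f = u ∧ P.normUtil g = v ∧ R.rel X P f g

/-- Welfarism. -/
theorem rel_iff_utilRel [Infinite 𝕏] [Nonempty (Fin n)] (hPar : R.Pareto) (hIIE : R.IIE)
    (hBI : R.BeliefIrrelevance) {X : Menu 𝕏} (P : Profile Ω X n) (f g : Act Ω X) :
    R.rel X P f g ↔ R.utilRel (P.normUtil f) (P.normUtil g) := by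
  refine ⟨fun h => ⟨X, P, f, g, rfl, rfl, h⟩, ?_⟩
  rintro ⟨X', P', f', g', hf, hg, h⟩
  obtain ⟨i⟩ := ‹Nonempty (Fin n)›
  have : Nonempty (Fin n) := ⟨i⟩
  obtain ⟨S, hS, hS'⟩ := rel_iff_rel_const hPar hIIE hBI P f g
  obtain ⟨T, hT, hT'⟩ := rel_iff_rel_const hPar hIIE hBI P' f' g'
  -- With outcomes outside `S ∪ T`, a single problem `Q` serves both comparisons, and both become
  -- the comparison of `a 0` with `a 1`.
  obtain ⟨e, he, hav⟩ := exists_injective_seq_avoiding (hS.union hT)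
  obtain ⟨Z, Q, a, hZ, ha⟩ := Profile.exists_of_seq_cube he
    (s := fun k => if k = 0 then P.normUtil f else P.normUtil g)
    (fun k => by split_ifs <;> exact P.normUtil_mem _) (P.isSEURep i).belief
  have h0 : Q.normUtil (Act.const (a 0)) = P.normUtil f := ha 0
  have h1 : Q.normUtil (Act.const (a 1)) = P.normUtil g := ha 1
  have hd : Disjoint (S ∪ T) Z.carrier := by
    rw [hZ, Set.disjoint_right]
    rintro _ ⟨k, rfl⟩
    exact hav k
  rw [hS' Z Q (hd.mono_left Set.subset_union_left) _ _ h0 h1]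
  rwa [hT' Z Q (hd.mono_left Set.subset_union_right) _ _ (h0.trans hf.symm) (h1.trans hg.symm)] at h

end AggregationRule

end Welfarism

/-! ### Orders and functions on the cube -/

section CubeOrder

variable {n : ℕ}

/-- The point `t 1` of the cube. -/
def cubeDiag (n : ℕ) (t : unitInterval) : cube n := ⟨fun _ => t, fun _ => ⟨t.2.1, t.2.2⟩⟩

theorem continuous_cubeDiag : Continuous (cubeDiag n) :=
  Continuous.subtype_mk (continuous_pi fun _ => continuous_subtype_val) _

/-- A continuous monotonic weak order on the cube has a continuous monotonic representation that
is the identity on the diagonal. -/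
theorem exists_cube_representation {r : cube n → cube n → Prop}
    (htot : ∀ u v, r u v ∨ r v u) (htrans : ∀ u v w, r u v → r v w → r u w)
    (hmono : ∀ u v : cube n, (∀ i, v.1 i ≤ u.1 i) → r u v)
    (hstrict : ∀ u v : cube n, (∀ i, v.1 i < u.1 i) → ¬ r v u)
    (hcl : ∀ v, IsClosed {u | r u v}) (hcl' : ∀ v, IsClosed {u | r v u}) :
    ∃ ψ : cube n → ℝ, IsMonotonic ψ ∧ Continuous ψ ∧ (∀ t, ψ (cubeDiag n t) = t) ∧
      ∀ u v, r u v ↔ ψ v ≤ ψ u := by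
  have hex : ∀ u, ∃ t, r u (cubeDiag n t) ∧ r (cubeDiag n t) u := fun u => by
    -- The diagonal points weakly below `u` and those weakly above it form two nonempty closed sets
    -- covering `[0,1]`, so by connectedness they meet.
    have h := isPreconnected_closed_iff.1 (isPreconnected_univ (α := unitInterval))
      {t | r u (cubeDiag n t)} {t | r (cubeDiag n t) u}
      ((hcl' u).preimage continuous_cubeDiag) ((hcl u).preimage continuous_cubeDiag)
      (fun t _ => htot _ _) ⟨0, trivial, hmono _ _ fun i => (u.2 i).1⟩
      ⟨1, trivial, hmono _ _ fun i => (u.2 i).2⟩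
    obtain ⟨t, -, ht⟩ := h
    exact ⟨t, ht⟩
  choose τ hτ hτ' using hex
  have hdiag : ∀ s t, r (cubeDiag n s) (cubeDiag n t) ↔ t ≤ s := fun s t => by
    refine ⟨fun h => ?_, fun h => hmono _ _ fun _ => h⟩
    by_contra! hc
    exact hstrict _ _ (fun _ => hc) h
  have hrep : ∀ u v, r u v ↔ τ v ≤ τ u := fun u v => by
    rw [← hdiag]
    exact ⟨fun h => htrans _ _ _ (hτ' u) (htrans _ _ _ h (hτ v)),
      fun h => htrans _ _ _ (hτ u) (htrans _ _ _ h (hτ' v))⟩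
  have hτd : ∀ t, τ (cubeDiag n t) = t := fun t =>
    le_antisymm ((hdiag _ _).1 (hτ _)) ((hdiag _ _).1 (hτ' _))
  refine ⟨fun u => τ u, fun u v h => ?_, ?_, fun t => congrArg _ (hτd t), fun u v => hrep u v⟩
  · have := hstrict u v h
    rw [hrep] at this
    exact not_le.1 this
  -- Every level of `τ` is attained on the diagonal, so preimages of closed rays are contour sets of
  -- diagonal points.
  · refine continuous_subtype_val.comp (continuous_iff_lower_upperSemicontinuous.2
      ⟨lowerSemicontinuous_iff_isClosed_preimage.2 fun y => ?_,
        upperSemicontinuous_iff_isClosed_preimage.2 fun y => ?_⟩)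
    · convert hcl' (cubeDiag n y) using 1
      ext u
      simp [hrep, hτd]
    · convert hcl (cubeDiag n y) using 1
      ext u
      simp [hrep, hτd]

variable {ψ : cube n → ℝ}

/-- Certainty independence of a function on the cube. -/
def IsCertaintyAffine (ψ : cube n → ℝ) : Prop :=
  ∀ (u v : cube n) (α c : ℝ), 0 < α → α < 1 → 0 ≤ c → c ≤ 1 →
    (∀ i, v.1 i = α * u.1 i + (1 - α) * c) → ψ v = α * ψ u + (1 - α) * c

/-- Scaling by `α < 1` is mixing with the constant 0; for `α > 1` exchange `u` and `v`. -/
theorem IsCertaintyAffine.isHomogeneous (h : IsCertaintyAffine ψ) : IsHomogeneous ψ := by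
  intro u v α hα huv
  rcases lt_trichotomy α 1 with h1 | rfl | h1
  · have := h u v α 0 hα h1 le_rfl zero_le_one (fun i => by rw [huv]; ring)
    linarith
  · have : v = u := Subtype.ext (funext fun i => by rw [huv, one_mul])
    rw [this, one_mul]
  · have := h v u α⁻¹ 0 (inv_pos.2 hα) (inv_lt_one_of_one_lt₀ h1) le_rfl zero_le_one
      (fun i => by rw [huv]; field_simp; ring)
    rw [this]
    field_simp
    ring

/-- For `v = u + c` with `c ≥ 0`, the point `v / 2` is a half mixture in two ways: of `v` with 0,
and of `u` with `c`. Comparing the two values of `ψ` gives the claim. -/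
theorem IsCertaintyAffine.isTranslationInvariant [Nonempty (Fin n)] (h : IsCertaintyAffine ψ) :
    IsTranslationInvariant ψ := by
  have hpos : ∀ (u v : cube n) (c : ℝ), 0 ≤ c → (∀ i, v.1 i = u.1 i + c) → ψ v = ψ u + c := by
    intro u v c hc huv
    obtain ⟨i₀⟩ := ‹Nonempty (Fin n)›
    have hc1 : c ≤ 1 := by linarith [huv i₀, (u.2 i₀).1, (v.2 i₀).2]
    let w : cube n := ⟨fun i => 1 / 2 * v.1 i, fun i => by
      have := v.2 i
      constructor <;> linarith⟩
    have e1 := h v w (1 / 2) 0 (by norm_num) (by norm_num) le_rfl zero_le_one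
      (fun i => by simp [w])
    have e2 := h u w (1 / 2) c (by norm_num) (by norm_num) hc hc1
      (fun i => by simp only [w, huv]; ring)
    linarith
  intro u v c huv
  rcases le_total 0 c with hc | hc
  · exact hpos u v c hc huv
  · have := hpos v u (-c) (by linarith) (fun i => by rw [huv]; ring)
    linarith

theorem isCertaintyAffine_of_homogeneous (hh : IsHomogeneous ψ) (ht : IsTranslationInvariant ψ) :
    IsCertaintyAffine ψ := by
  intro u v α c hα hα1 _ _ huv
  let w : cube n := ⟨fun i => α * u.1 i, fun i =>
    ⟨mul_nonneg hα.le (u.2 i).1, mul_le_one₀ hα1.le (u.2 i).1 (u.2 i).2⟩⟩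
  rw [ht w v ((1 - α) * c) huv, hh u w α hα fun _ => rfl]

/-- `IsMonotonic` speaks only of strict inequality in all coordinates. Shrinking `u` towards 0 and
moving `v` towards 1 makes the inequalities strict inside the cube; then pass to the limit. -/
theorem IsMonotonic.le_of_le (hm : IsMonotonic ψ) (hc : Continuous ψ) {u v : cube n}
    (h : ∀ i, u.1 i ≤ v.1 i) : ψ u ≤ ψ v := by
  let a : unitInterval → cube n := fun t => ⟨fun i => (1 - t) * u.1 i, fun i =>
    ⟨mul_nonneg (sub_nonneg.2 t.2.2) (u.2 i).1,
      mul_le_one₀ (by linarith [t.2.1]) (u.2 i).1 (u.2 i).2⟩⟩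
  let b : unitInterval → cube n := fun t => ⟨fun i => (1 - t) * v.1 i + t, fun i => by
    have h0 := t.2.1
    have h1 := t.2.2
    have h2 := (v.2 i).1
    have h3 := (v.2 i).2
    constructor <;> nlinarith⟩
  have ha : Continuous a := by fun_prop
  have hb : Continuous b := by fun_prop
  have ha0 : a 0 = u := Subtype.ext (by simp [a])
  have hb0 : b 0 = v := Subtype.ext (by simp [b])
  let t : ℕ → unitInterval := fun k => ⟨1 / ((k : ℝ) + 1), by positivity,
    div_le_one_of_le₀ (by linarith [(k.cast_nonneg : (0 : ℝ) ≤ k)]) (by positivity)⟩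
  have htl : Tendsto t atTop (𝓝 0) :=
    tendsto_subtype_rng.2 tendsto_one_div_add_atTop_nhds_zero_nat
  have la : Tendsto (fun k => ψ (a (t k))) atTop (𝓝 (ψ u)) := by
    have := ((hc.comp ha).tendsto 0).comp htl
    rwa [Function.comp_apply, ha0] at this
  have lb : Tendsto (fun k => ψ (b (t k))) atTop (𝓝 (ψ v)) := by
    have := ((hc.comp hb).tendsto 0).comp htl
    rwa [Function.comp_apply, hb0] at this
  refine le_of_tendsto_of_tendsto' la lb fun k => (hm _ _ fun i => ?_).le
  have h1 : (0 : ℝ) < t k := by simp only [t]; positivity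
  have h2 : (t k : ℝ) ≤ 1 := (t k).2.2
  have := mul_le_mul_of_nonneg_left (h i) (sub_nonneg.2 h2)
  simp only [a, b]
  linarith

end CubeOrder

/-! ### Beliefs with prescribed probabilities -/

section Beliefs

variable {Ω : Type*} [MeasurableSpace Ω] {p q : Measure Ω}

theorem IsNonatomic.smul (hp : IsNonatomic p) {c : ENNReal} (hc : c ≠ ⊤) :
    IsNonatomic (c • p) := by
  intro E hE h
  simp only [Measure.smul_apply, smul_eq_mul] at h ⊢
  have hc0 : c ≠ 0 := fun h0 => by simp [h0] at h
  obtain ⟨F, hF, hFE, h0, h1⟩ := hp E hE (pos_iff_ne_zero.2 (right_ne_zero_of_mul h.ne'))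
  exact ⟨F, hF, hFE, ENNReal.mul_pos hc0 h0.ne', ENNReal.mul_lt_mul_right hc0 hc h1⟩

theorem IsNonatomic.restrict [IsFiniteMeasure p] (hp : IsNonatomic p) {A : Set Ω}
    (hA : MeasurableSet A) : IsNonatomic (p.restrict A) := by
  intro E hE h
  rw [Measure.restrict_apply hE] at h
  obtain ⟨F, hF, hFE, h0, h1⟩ := hp _ (hE.inter hA) h
  have hFA : F ∩ A = F := Set.inter_eq_left.2 (hFE.trans Set.inter_subset_right)
  refine ⟨F, hF, hFE.trans Set.inter_subset_left, ?_, ?_⟩ <;>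
    rw [Measure.restrict_apply hF, hFA]
  · exact h0
  · rwa [Measure.restrict_apply hE]

theorem IsNonatomic.add [IsFiniteMeasure p] [IsFiniteMeasure q] (hp : IsNonatomic p)
    (hq : IsNonatomic q) : IsNonatomic (p + q) := by
  intro E hE h
  simp only [Measure.add_apply] at h ⊢
  rcases eq_or_ne (p E) 0 with he | he
  · rw [he, zero_add] at h
    obtain ⟨F, hF, hFE, h0, h1⟩ := hq E hE h
    refine ⟨F, hF, hFE, h0.trans_le le_add_self, ?_⟩
    exact ENNReal.add_lt_add_of_le_of_lt (measure_ne_top _ _) (measure_mono hFE) h1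
  · obtain ⟨F, hF, hFE, h0, h1⟩ := hp E hE (pos_iff_ne_zero.2 he)
    refine ⟨F, hF, hFE, h0.trans_le le_self_add, ?_⟩
    exact ENNReal.add_lt_add_of_lt_of_le (measure_ne_top _ _) h1 (measure_mono hFE)

/-- Give the conditionals of `p` on `E` and `Eᶜ` the weights `a` and `1 - a`. As `G` takes the share
`α` of each half, it is independent of `E` under every such `q`. The events do not depend on `a`, so
individuals with different `a` share the same bet and the same mixing event. -/
theorem IsBelief.exists_reweight (hp : IsBelief p) {α : ℝ} (hα0 : 0 ≤ α) (hα1 : α ≤ 1) :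
    ∃ E G : Set Ω, MeasurableSet E ∧ MeasurableSet G ∧ ∀ a : ℝ, 0 ≤ a → a ≤ 1 →
      ∃ q : Measure Ω, IsBelief q ∧ q.real E = a ∧ q.real (G ∩ E) = α * a ∧ q.real G = α := by
  have := hp.1
  obtain ⟨E, hE, -, hpE⟩ := hp.2.exists_subset_real_eq MeasurableSet.univ (t := 1 / 2)
    (by norm_num) (by simp; norm_num)
  have hpE' : p.real Eᶜ = 1 / 2 := by rw [probReal_compl_eq_one_sub hE, hpE]; norm_num
  obtain ⟨A, hA, hAE, hpA⟩ := hp.2.exists_subset_real_eq hE (t := α / 2)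
    (by linarith) (by linarith)
  obtain ⟨B, hB, hBE, hpB⟩ := hp.2.exists_subset_real_eq hE.compl (t := α / 2)
    (by linarith) (by linarith)
  have hAE' : Disjoint A Eᶜ := disjoint_compl_right.mono_left hAE
  have hBE' : Disjoint B E := disjoint_compl_left.mono_left hBE
  have hAB : (A ∪ B) ∩ E = A := by
    rw [Set.union_inter_distrib_right, Set.inter_eq_left.2 hAE,
      hBE'.inter_eq, Set.union_empty]
  have hAB' : (A ∪ B) ∩ Eᶜ = B := by
    rw [Set.union_inter_distrib_right, Set.inter_eq_left.2 hBE,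
      hAE'.inter_eq, Set.empty_union]
  refine ⟨E, A ∪ B, hE, hA.union hB, fun a ha0 ha1 => ?_⟩
  let q : Measure Ω := ENNReal.ofReal (2 * a) • p.restrict E +
    ENNReal.ofReal (2 * (1 - a)) • p.restrict Eᶜ
  have hf1 : IsFiniteMeasure (ENNReal.ofReal (2 * a) • p.restrict E) :=
    Measure.smul_finite _ ENNReal.ofReal_ne_top
  have hf2 : IsFiniteMeasure (ENNReal.ofReal (2 * (1 - a)) • p.restrict Eᶜ) :=
    Measure.smul_finite _ ENNReal.ofReal_ne_top
  have hq : ∀ F, MeasurableSet F →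
      q.real F = 2 * a * p.real (F ∩ E) + 2 * (1 - a) * p.real (F ∩ Eᶜ) := fun F hF => by
    rw [measureReal_add_apply, measureReal_ennreal_smul_apply, measureReal_ennreal_smul_apply,
      ENNReal.toReal_ofReal (by linarith), ENNReal.toReal_ofReal (by linarith),
      measureReal_restrict_apply hF, measureReal_restrict_apply hF]
  have huniv : q.real Set.univ = 1 := by
    rw [hq _ MeasurableSet.univ, Set.univ_inter, Set.univ_inter, hpE, hpE']; ring
  refine ⟨q, ⟨⟨?_⟩, ?_⟩, ?_, ?_, ?_⟩
  · rwa [measureReal_def, ENNReal.toReal_eq_one_iff] at huniv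
  · exact ((hp.2.restrict hE).smul ENNReal.ofReal_ne_top).add
      ((hp.2.restrict hE.compl).smul ENNReal.ofReal_ne_top)
  · rw [hq _ hE, Set.inter_self, Set.inter_compl_self, hpE, measureReal_empty]; ring
  · rw [hAB, hq _ hA, Set.inter_eq_left.2 hAE, hpA, hAE'.inter_eq, measureReal_empty]
    ring
  · rw [hq _ (hA.union hB), hAB, hAB', hpA, hpB]; ring

end Beliefs

/-! ### Pseudo-mixtures, the representation and the axioms -/

section Main

variable {Ω : Type*} [MeasurableSpace Ω] {𝕏 : Type*} {n : ℕ}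

theorem Profile.normUtil_pseudoMix {X : Menu 𝕏} {P : Profile Ω X n} {α : ℝ} {f h : Act Ω X}
    {x : X.carrier} (hm : P.IsPseudoMix α f x h) (i : Fin n) :
    P.normUtil h i = α * P.normUtil f i + (1 - α) * P.normValue i x :=
  seu_pseudoMix _ _ (hm i).1 (hm i).2

/-- Pseudo-mixing is conditioning on an event `G` that everybody finds of probability `α` and
independent of the level sets of `f`. -/
theorem Profile.isPseudoMix_splice {X : Menu 𝕏} {P : Profile Ω X n} {α : ℝ} {f : Act Ω X}
    {x : X.carrier} {G : Set Ω} (hG : MeasurableSet G) (hα : ∀ i, (P.belief i).real G = α)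
    (hf : ∀ i y, (P.belief i).real (G ∩ f.toFun ⁻¹' {y}) = α * (P.belief i).real (f.toFun ⁻¹' {y})) :
    P.IsPseudoMix α f x (Act.splice hG f (Act.const x)) := by
  intro i
  constructor
  · have : (Act.splice hG f (Act.const x)).toFun ⁻¹' {x} = (G ∩ f.toFun ⁻¹' {x}) ∪ Gᶜ := by
      ext ω
      by_cases h : ω ∈ G
      · simp [Act.splice_of_mem hG _ _ h, h]
      · simp [Act.splice_of_notMem hG _ _ h, h, Act.const]
    rw [this, measureReal_union (disjoint_compl_right.mono_left Set.inter_subset_left) hG.compl, hf,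
      probReal_compl_eq_one_sub hG, hα]
  · intro y hy
    rw [← hf]
    congr 1
    ext ω
    by_cases h : ω ∈ G
    · simp [Act.splice_of_mem hG _ _ h, h]
    · simp [Act.splice_of_notMem hG _ _ h, h, Act.const, hy.symm]

theorem Profile.isPseudoMix_splice_const {X : Menu 𝕏} {P : Profile Ω X n} {α : ℝ}
    {x z : X.carrier} {G : Set Ω} (hG : MeasurableSet G) (hα : ∀ i, (P.belief i).real G = α) :
    P.IsPseudoMix α (Act.const z) x (Act.splice hG (Act.const z) (Act.const x)) := by
  refine Profile.isPseudoMix_splice hG hα fun i y => ?_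
  by_cases h : z = y
  · simp [Act.const, h, hα]
  · simp [Act.const, h]

theorem Profile.isPseudoMix_splice_bet {X : Menu 𝕏} {P : Profile Ω X n} {α : ℝ}
    {x y z : X.carrier} (hxy : x ≠ y) {E G : Set Ω} (hE : MeasurableSet E) (hG : MeasurableSet G)
    (hα : ∀ i, (P.belief i).real G = α)
    (hαE : ∀ i, (P.belief i).real (G ∩ E) = α * (P.belief i).real E) :
    P.IsPseudoMix α (Act.splice hE (Act.const x) (Act.const y)) z
      (Act.splice hG (Act.splice hE (Act.const x) (Act.const y)) (Act.const z)) := by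
  refine Profile.isPseudoMix_splice hG hα fun i w => ?_
  have hmem : ∀ ω, (Act.splice hE (Act.const x) (Act.const y)).toFun ω = w ↔
      (ω ∈ E ∧ x = w) ∨ (ω ∉ E ∧ y = w) := fun ω => by
    by_cases h : ω ∈ E
    · simp [Act.splice_of_mem hE _ _ h, h, Act.const]
    · simp [Act.splice_of_notMem hE _ _ h, h, Act.const]
  by_cases hx : x = w
  · have : (Act.splice hE (Act.const x) (Act.const y)).toFun ⁻¹' {w} = E := by
      ext ω
      have : y ≠ w := fun h => hxy (hx.trans h.symm)
      rw [Set.mem_preimage, Set.mem_singleton_iff, hmem]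
      simp [hx, this]
    rw [this, hαE]
  by_cases hy : y = w
  · have : (Act.splice hE (Act.const x) (Act.const y)).toFun ⁻¹' {w} = Eᶜ := by
      ext ω
      rw [Set.mem_preimage, Set.mem_singleton_iff, hmem]
      simp [hx, hy]
    have h2 : (P.belief i).real (G ∩ Eᶜ) =
        (P.belief i).real G - (P.belief i).real (G ∩ E) := by
      have := measureReal_inter_add_sdiff (μ := P.belief i) (s := G) hE
      rw [← Set.sdiff_eq]
      linarith
    rw [this, h2, hα, hαE, probReal_compl_eq_one_sub hE]
    ring
  · have : (Act.splice hE (Act.const x) (Act.const y)).toFun ⁻¹' {w} = ∅ := by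
      ext ω
      simp [hmem, hx, hy]
    simp [this]

namespace AggregationRule

variable {R : AggregationRule Ω 𝕏 n}

/-- Each property of an order required for the representation involves at most countably many points
of the cube, and these are the utility vectors of outcomes in one problem, where the axioms apply.
-/
theorem exists_utilRel_representation [Infinite 𝕏] [Nonempty (Fin n)] {p : Measure Ω}
    (hp : IsBelief p) (hPar : R.Pareto) (hCon : R.Continuity) (hIIE : R.IIE)
    (hBI : R.BeliefIrrelevance) :
    ∃ ψ : cube n → ℝ, IsMonotonic ψ ∧ Continuous ψ ∧ (∀ t, ψ (cubeDiag n t) = t) ∧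
      ∀ u v, R.utilRel u.1 v.1 ↔ ψ v ≤ ψ u := by
  have hreal : ∀ s : ℕ → cube n, ∃ (Z : Menu 𝕏) (Q : Profile Ω Z n) (a : ℕ → Z.carrier),
      ∀ k, Q.normUtil (Act.const (a k)) = (s k).1 := fun s => by
    obtain ⟨Z, Q, a, -, ha⟩ := Profile.exists_of_seq_cube (Infinite.natEmbedding 𝕏).injective
      (fun k => (s k).2) hp
    exact ⟨Z, Q, a, ha⟩
  have hrel : ∀ {X : Menu 𝕏} (P : Profile Ω X n) (f g : Act Ω X),
    R.rel X P f g ↔ R.utilRel (P.normUtil f) (P.normUtil g) := rel_iff_utilRel hPar hIIE hBI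
  have hthree : ∀ u v w : cube n, ∃ (Z : Menu 𝕏) (Q : Profile Ω Z n) (a b c : Z.carrier),
      Q.normUtil (Act.const a) = u.1 ∧ Q.normUtil (Act.const b) = v.1 ∧
        Q.normUtil (Act.const c) = w.1 := fun u v w => by
    obtain ⟨Z, Q, a, ha⟩ := hreal fun k => if k = 0 then u else if k = 1 then v else w
    exact ⟨Z, Q, a 0, a 1, a 2, ha 0, ha 1, ha 2⟩
  have hseq : ∀ (s : ℕ → cube n) (u v : cube n), ∃ (Z : Menu 𝕏) (Q : Profile Ω Z n)
      (a : ℕ → Z.carrier) (b c : Z.carrier), (∀ k, Q.normUtil (Act.const (a k)) = (s k).1) ∧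
      Q.normUtil (Act.const b) = u.1 ∧ Q.normUtil (Act.const c) = v.1 := fun s u v => by
    obtain ⟨Z, Q, a, ha⟩ := hreal fun k => match k with
      | 0 => u
      | 1 => v
      | k + 2 => s k
    exact ⟨Z, Q, fun k => a (k + 2), a 0, a 1, fun k => ha (k + 2), ha 0, ha 1⟩
  refine exists_cube_representation (r := fun u v => R.utilRel u.1 v.1)
    (fun u v => ?_) (fun u v w => ?_) (fun u v h => ?_) (fun u v h => ?_) (fun v => ?_)
    (fun v => ?_)
  · obtain ⟨Z, Q, a, b, c, ha, hb, hc⟩ := hthree u v u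
    rw [← ha, ← hb, ← hrel, ← hrel]
    exact R.complete _ _ _ _
  · obtain ⟨Z, Q, a, b, c, ha, hb, hc⟩ := hthree u v w
    rw [← ha, ← hb, ← hc, ← hrel, ← hrel, ← hrel]
    exact R.transitive _ _ _ _ _
  · obtain ⟨Z, Q, a, b, c, ha, hb, hc⟩ := hthree u v u
    rw [← ha, ← hb]
    rw [← hrel]
    exact hPar.rel_of_le (by rw [ha, hb]; exact h)
  · obtain ⟨Z, Q, a, b, c, ha, hb, hc⟩ := hthree u v u
    rw [← ha, ← hb]
    rw [← hrel]
    refine ((hPar Z Q _ _).2 fun i => ?_).2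
    rw [Q.pref_iff, Q.pref_iff, ha, hb]
    exact ⟨(h i).le, not_le.2 (h i)⟩
  · refine IsSeqClosed.isClosed fun s u hs hlim => ?_
    obtain ⟨Z, Q, a, b, c, ha, hb, hc⟩ := hseq s u v
    simp only [Set.mem_ofPred_eq, ← ha, ← hc, ← hrel] at hs
    rw [Set.mem_ofPred_eq, ← hb, ← hc, ← hrel]
    refine (hCon Z Q (Act.const b) _ _ ?_).1 hs
    simp only [ha, hb]
    exact (continuous_subtype_val.tendsto u).comp hlim
  · refine IsSeqClosed.isClosed fun s u hs hlim => ?_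
    obtain ⟨Z, Q, a, b, c, ha, hb, hc⟩ := hseq s u v
    simp only [Set.mem_ofPred_eq, ← ha, ← hc, ← hrel] at hs
    rw [Set.mem_ofPred_eq, ← hb, ← hc, ← hrel]
    refine (hCon Z Q (Act.const b) _ _ ?_).2 hs
    simp only [ha, hb]
    exact (continuous_subtype_val.tendsto u).comp hlim

theorem isCertaintyAffine_of_rci [Infinite 𝕏] {p : Measure Ω} (hp : IsBelief p)
    (hRCI : R.RestrictedCertaintyIndependence) {ψ : cube n → ℝ} (hmono : IsMonotonic ψ)
    (hcont : Continuous ψ) (hdiag : ∀ t, ψ (cubeDiag n t) = t)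
    (hrep : ∀ (X : Menu 𝕏) (P : Profile Ω X n) (f g : Act Ω X), R.rel X P f g ↔
      ψ ⟨P.normUtil f, P.normUtil_mem f⟩ ≥ ψ ⟨P.normUtil g, P.normUtil_mem g⟩) :
    IsCertaintyAffine ψ := by
  intro u v α c hα0 hα1 hc0 hc1 huv
  have ht0 : 0 ≤ ψ u := by
    have := hmono.le_of_le hcont (u := cubeDiag n 0) (v := u) fun i => (u.2 i).1
    rwa [hdiag] at this
  have ht1 : ψ u ≤ 1 := by
    have := hmono.le_of_le hcont (u := u) (v := cubeDiag n 1) fun i => (u.2 i).2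
    rwa [hdiag] at this
  obtain ⟨E, G, hE, hG, hq⟩ := hp.exists_reweight hα0.le hα1.le
  choose q hqb hqE hqGE hqG using fun i => hq (u.1 i) (u.2 i).1 (u.2 i).2
  -- Common values of the outcomes: 0 and 1 are the prizes of the bet, `c` is mixed in, and `ψ u` is
  -- the sure equivalent; later outcomes merely repeat it.
  let s : ℕ → ℝ := fun k => match k with
    | 0 => 0
    | 1 => 1
    | 2 => c
    | _ => ψ u
  have hs : ∀ k, 0 ≤ s k ∧ s k ≤ 1 := fun k => match k with
    | 0 => by simp [s]
    | 1 => by simp [s]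
    | 2 => ⟨hc0, hc1⟩
    | _ + 3 => ⟨ht0, ht1⟩
  obtain ⟨Z, Q, a, -, ha, hb⟩ := Profile.exists_of_seq (Infinite.natEmbedding 𝕏).injective
    (v := fun k (_ : Fin n) => s k) (fun k _ => hs k) rfl rfl hqb
  have hcommon : ∀ i j x, Q.normValue i x = Q.normValue j x := fun i j x => by
    obtain ⟨k, rfl⟩ := a.surjective x
    rw [ha, ha]
  have hs2 : s 2 = c := rfl
  have hαG : ∀ i, (Q.belief i).real G = α := fun i => by rw [hb, hqG]
  set f : Act Ω Z := Act.splice hE (Act.const (a 1)) (Act.const (a 0)) with hf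
  set g : Act Ω Z := Act.const (a 3) with hg
  have hfm : Q.IsPseudoMix α f (a 2) (Act.splice hG f (Act.const (a 2))) :=
    Profile.isPseudoMix_splice_bet (a.injective.ne one_ne_zero) hE hG hαG fun i => by
      rw [hb, hqGE, hqE]
  have hgm : Q.IsPseudoMix α g (a 2) (Act.splice hG g (Act.const (a 2))) :=
    Profile.isPseudoMix_splice_const hG hαG
  have huf : Q.normUtil f = u.1 := funext fun i => by
    rw [hf, Profile.normUtil, seu_bet, ha, ha, hb, hqE]
    simp [s]
  have hug : Q.normUtil g = (cubeDiag n ⟨ψ u, ht0, ht1⟩).1 := funext fun i => by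
    rw [hg, Profile.normUtil_const, ha]
    rfl
  have hm0 : 0 ≤ α * ψ u + (1 - α) * c :=
    add_nonneg (mul_nonneg hα0.le ht0) (mul_nonneg (by linarith) hc0)
  have hm1 : α * ψ u + (1 - α) * c ≤ 1 := by nlinarith
  have hufm : Q.normUtil (Act.splice hG f (Act.const (a 2))) = v.1 := funext fun i => by
    rw [Profile.normUtil_pseudoMix hfm, huf, ha, huv, hs2]
  have hugm : Q.normUtil (Act.splice hG g (Act.const (a 2))) =
      (cubeDiag n ⟨α * ψ u + (1 - α) * c, hm0, hm1⟩).1 := funext fun i => by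
    rw [Profile.normUtil_pseudoMix hgm, hug, ha]
    rfl
  -- The acts `f` and `g` are indifferent, so both directions survive mixing; `ψ` of the mixed
  -- diagonal point is known.
  have h1 := hRCI Z Q hcommon f g (a 2) α hα0 hα1 _ _ hfm hgm
  have h2 := hRCI Z Q hcommon g f (a 2) α hα0 hα1 _ _ hgm hfm
  simp only [hrep, huf, hug, hufm, hugm, Subtype.coe_eta, hdiag, ge_iff_le, le_refl,
    true_iff] at h1 h2
  exact le_antisymm h2 h1

theorem axioms_of_representation {ψ : cube n → ℝ} (hmono : IsMonotonic ψ) (hcont : Continuous ψ)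
    (haff : IsCertaintyAffine ψ)
    (hrep : ∀ (X : Menu 𝕏) (P : Profile Ω X n) (f g : Act Ω X), R.rel X P f g ↔
      ψ ⟨P.normUtil f, P.normUtil_mem f⟩ ≥ ψ ⟨P.normUtil g, P.normUtil_mem g⟩) [Nonempty (Fin n)] :
    R.Pareto ∧ R.Continuity ∧ R.IIE ∧ R.BeliefIrrelevance ∧
      R.RestrictedCertaintyIndependence := by
  refine ⟨fun X P f g => ⟨fun h => ?_, fun h => ?_⟩, fun X P f g s hs => ?_, ?_, ?_, ?_⟩
  · rw [hrep]
    exact hmono.le_of_le hcont fun i => (P.pref_iff i f g).1 (h i)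
  · have := hmono ⟨P.normUtil f, P.normUtil_mem f⟩ ⟨P.normUtil g, P.normUtil_mem g⟩ fun i => by
      have := (h i).2
      rw [P.pref_iff] at this
      exact not_le.1 this
    rw [hrep, hrep]
    exact ⟨this.le, not_le.2 this⟩
  · have hlim : Tendsto (fun t => ψ ⟨P.normUtil (s t), P.normUtil_mem _⟩) atTop
        (𝓝 (ψ ⟨P.normUtil f, P.normUtil_mem f⟩)) :=
      (hcont.tendsto _).comp (tendsto_subtype_rng.2 hs)
    simp only [hrep]
    exact ⟨fun h => ge_of_tendsto' hlim h, fun h => le_of_tendsto' hlim h⟩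
  · intro X X' P P' hI h f g
    simp only [hrep, hI.normUtil_incl h]
  · intro X P P' hv x y
    have : ∀ z, P.normUtil (Act.const z) = P'.normUtil (Act.const z) := fun z => funext fun i => by
      rw [Profile.normUtil_const, Profile.normUtil_const, hv]
    simp only [hrep, this]
  · intro X P hcommon f g x α hα0 hα1 fx gx hfx hgx
    obtain ⟨i₀⟩ := ‹Nonempty (Fin n)›
    -- Everybody values `x` alike, so mixing moves the utility vector towards a diagonal point.
    have key : ∀ h hx : Act Ω X, P.IsPseudoMix α h x hx →
        ψ ⟨P.normUtil hx, P.normUtil_mem hx⟩ =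
          α * ψ ⟨P.normUtil h, P.normUtil_mem h⟩ + (1 - α) * P.normValue i₀ x := fun h hx hm =>
      haff _ _ α _ hα0 hα1 (P.normValue_mem i₀ x).1 (P.normValue_mem i₀ x).2 fun i => by
        rw [hcommon i₀ i]
        exact Profile.normUtil_pseudoMix hm i
    rw [hrep, hrep, key _ _ hfx, key _ _ hgx, ge_iff_le, ge_iff_le, add_le_add_iff_right,
      mul_le_mul_iff_right₀ hα0]

end AggregationRule

end Main

end

theorem lemma4 {Ω : Type*} [MeasurableSpace Ω] [Infinite Ω] {𝕏 : Type*} [Infinite 𝕏]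
    (n : ℕ) (hn : 2 ≤ n) (R : AggregationRule Ω 𝕏 n) :
    (R.Pareto ∧ R.Continuity ∧ R.IIE ∧ R.BeliefIrrelevance ∧
      R.RestrictedCertaintyIndependence) ↔
    ∃ ψ : cube n → ℝ,
      IsMonotonic ψ ∧ Continuous ψ ∧ IsHomogeneous ψ ∧ IsTranslationInvariant ψ ∧
      ∀ (X : Menu 𝕏) (P : Profile Ω X n) (f g : Act Ω X),
        R.rel X P f g ↔
          ψ ⟨P.normUtil f, P.normUtil_mem f⟩ ≥ ψ ⟨P.normUtil g, P.normUtil_mem g⟩ := by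
  have : Nonempty (Fin n) := ⟨⟨0, by omega⟩⟩
  constructor
  · rintro ⟨hPar, hCon, hIIE, hBI, hRCI⟩
    by_cases hp : ∃ p : Measure Ω, IsBelief p
    · obtain ⟨p, hp⟩ := hp
      obtain ⟨ψ, hmono, hcont, hdiag, hψ⟩ :=
        AggregationRule.exists_utilRel_representation hp hPar hCon hIIE hBI
      have hrep : ∀ (X : Menu 𝕏) (P : Profile Ω X n) (f g : Act Ω X), R.rel X P f g ↔
          ψ ⟨P.normUtil f, P.normUtil_mem f⟩ ≥ ψ ⟨P.normUtil g, P.normUtil_mem g⟩ :=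
        fun X P f g => (AggregationRule.rel_iff_utilRel hPar hIIE hBI P f g).trans (hψ ⟨_, _⟩ ⟨_, _⟩)
      have haff := AggregationRule.isCertaintyAffine_of_rci hp hRCI hmono hcont hdiag hrep
      exact ⟨ψ, hmono, hcont, haff.isHomogeneous, haff.isTranslationInvariant, hrep⟩
    · obtain ⟨i⟩ := this
      exact ⟨fun u => u.1 i, fun u v h => h i,
        (continuous_apply i).comp continuous_subtype_val, fun u v α _ h => h i,
        fun u v c h => h i, fun X P => absurd ⟨_, (P.isSEURep i).belief⟩ hp⟩
  · rintro ⟨ψ, hmono, hcont, hhom, htr, hrep⟩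
    exact AggregationRule.axioms_of_representation hmono hcont
      (isCertaintyAffine_of_homogeneous hhom htr) hrep
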